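/- For $g\in L^2(\mathbb R)$ write $\hat g$ for its Fourier transform, normalised by $\hat g(\xi)=\int_{\mathbb R} g(t)e^{-2\pi i\xi t}\,dt$ on integrable functions, and let $G(g)=\{e^{2\pi i n t}g(t-m)\}_{(m,n)\in\mathbb Z^2}$. We say that $G(g)$ is a Riesz basis with bounds $A,B>0$ if it is complete in $L^2(\mathbb R)$ and, for every $(a_{m,n})\in\ell^2(\mathbb Z^2)$, the series $\sum a_{m,n}e^{2\pi i n t}g(t-m)$ converges unconditionally in $L^2(\mathbb R)$ with $$A\sum|a_{m,n}|^2\le\Big\|\sum a_{m,n}e^{2\pi i n t}g(t-m)\Big\|_{L^2(\mathbb R)}^2\le B\sum|a_{m,n}|^2 .$$ **Theorem.** For all $A,B>0$ there is a constant $C=C(A,B)>0$ such that, for every $g\in L^2(\mathbb R)$ for which $G(g)$ is a Riesz basis with bounds $A,B$, the following hold. 1. For all $1\le p\le 2$ and $q\in[2,\infty]$ with $\frac1p+\frac1q=1$, and all real $R,L\ge 1$, $$\sum_{k\in\mathbb Z,\,|k|>R}\|g\|_{L^q(k,k+1)}^p+\sum_{k\in\mathbb Z,\,|k|>L}\|\hat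 g\|_{L^q(k,k+1)}^p>\frac{C}{(RL)^{p/q}},$$ where the sums take values in $[0,\infty]$ and $p/q=0$ if $q=\infty$. 2. (Recovered by the case $p=q=2$.) For all real $R,L\ge1$, $$\int_{|t|\ge R}|g(t)|^2\,dt+\int_{|\xi|\ge L}|\hat g(\xi)|^2\,d\xi\ge\frac{C}{RL}.$$ 3. (Recovered by the case $p=1$, $q=\infty$; the Amalgam Balian–Low theorem.) $$\sum_{k\in\mathbb Z}\|g\|_{L^\infty(k,k+1)}=\infty\quad\text{or}\quad\sum_{k\in\mathbb Z}\|\hat g\|_{L^\infty(k,k+1)}=\infty .$$ -/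

import Mathlib

open MeasureTheory
open scoped ENNReal FourierTransform

noncomputable section

/-- The family `f` in the Hilbert space `H` is a Riesz basis, and `A`, `B` are admissible
constants for it: `f` is complete, and for every square-summable sequence `a` the series
`∑ aᵢ fᵢ` converges (unconditionally) in `H` and
`A ∑ |aᵢ|² ≤ ‖∑ aᵢ fᵢ‖² ≤ B ∑ |aᵢ|²`. -/
structure IsRieszBasisWithBounds {ι H : Type*} [NormedAddCommGroup H] [InnerProductSpace ℂ H]
    [CompleteSpace H] (A B : ℝ) (f : ι → H) : Prop where
  lower_pos : 0 < A
  upper_pos : 0 < B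
  complete : (Submodule.span ℂ (Set.range f)).topologicalClosure = ⊤
  summable : ∀ a : lp (fun _ : ι => ℂ) 2, Summable fun i => a i • f i
  lower : ∀ a : lp (fun _ : ι => ℂ) 2, A * ∑' i, ‖a i‖ ^ 2 ≤ ‖∑' i, a i • f i‖ ^ 2
  upper : ∀ a : lp (fun _ : ι => ℂ) 2, ‖∑' i, a i • f i‖ ^ 2 ≤ B * ∑' i, ‖a i‖ ^ 2

/-- The time-frequency shift `t ↦ e^{2πint} g(t - m)`. -/
def timeFreqShift (g : ℝ → ℂ) (m n : ℤ) (t : ℝ) : ℂ :=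
  Complex.exp (2 * (Real.pi : ℂ) * Complex.I * (n : ℂ) * (t : ℂ)) * g (t - m)

theorem memLp_timeFreqShift {g : ℝ → ℂ} (hg : MemLp g 2 volume) (m n : ℤ) :
    MemLp (timeFreqShift g m n) 2 volume := by
  have h1 : MemLp (fun t : ℝ => g (t - m)) 2 volume :=
    hg.comp_measurePreserving (measurePreserving_sub_right volume (m : ℝ))
  refine h1.of_le ?_ (Filter.Eventually.of_forall fun t => ?_)
  · refine AEStronglyMeasurable.mul ?_ h1.aestronglyMeasurable
    exact Continuous.aestronglyMeasurable (by fun_prop)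
  · have : (2 * (Real.pi : ℂ) * Complex.I * (n : ℂ) * (t : ℂ))
        = ((2 * Real.pi * n * t : ℝ) : ℂ) * Complex.I := by push_cast; ring
    rw [timeFreqShift, norm_mul, this, Complex.norm_exp_ofReal_mul_I, one_mul]

/-- The Gabor system `G(g) = {e^{2πint} g(t - m)}`, indexed by `(m, n) ∈ ℤ × ℤ`, in `L²(ℝ)`. -/
def gaborSystem (g : Lp ℂ 2 (volume : Measure ℝ)) (mn : ℤ × ℤ) :
    Lp ℂ 2 (volume : Measure ℝ) :=
  (memLp_timeFreqShift (Lp.memLp g) mn.1 mn.2).toLp (timeFreqShift g mn.1 mn.2)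

/-- `‖f‖_{L^q(k, k+1)}`, with values in `[0, ∞]`. -/
def unitIntervalNorm (q : ℝ≥0∞) (f : ℝ → ℂ) (k : ℤ) : ℝ≥0∞ :=
  eLpNorm f q (volume.restrict (Set.Ioo (k : ℝ) ((k : ℝ) + 1)))

/-- `∑_{|k| > R} ‖f‖_{L^q(k, k+1)}^p`, the sum being over integers `k`, with values in `[0, ∞]`. -/
def amalgamTail (p q : ℝ≥0∞) (R : ℝ) (f : ℝ → ℂ) : ℝ≥0∞ :=
  ∑' k : {k : ℤ // R < |(k : ℝ)|}, unitIntervalNorm q f k ^ p.toReal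

end

/-! The Zak transform G(x, y) = ∑ g(x + k) e^{-2πiky} maps L²(ℝ) isometrically onto L² of the unit
square and turns e^{2πint} g(t - m) into e^{2πi(nx - my)} G(x, y). The characters form an
orthonormal basis there, so the Riesz bounds force √A ≤ |G| ≤ √B almost everywhere
(`IsQuasiPeriodic.ae_bounds`).

Since G(x + 1, y) = e^{2πiy} G(x, y) and G(x, y + 1) = G(x, y), a continuous G without zeros would
have a phase winding once around the boundary of the square, which is impossible. The discrete form:
every translate of a grid with steps 1/(mK) and 1/(mN) contains a jump of fixed size δ between
neighbours (`IsQuasiPeriodic.exists_jump`). Averaging over translates, the sets of horizontal and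
vertical jumps have total measure at least 1/(m²KN) (`IsQuasiPeriodic.inv_mul_le_measure_jump`).
Here N = ⌊R⌋, K = ⌊L⌋, and m depends on A and B only.

Small tails make these sets small. The slice f = G(x, ·) has Fourier coefficients g(x + k). Split
f(· + s) - f near frequency N by a de la Vallée Poussin mean. The low part is at most 40 √B N s
(`norm_lowDiff_le`), hence at most δ/2 for s = 1/(mN) and m large. The high part involves only
coefficients with |k| > R, and its level sets are controlled by their ℓ^p norm
(`unitMeasure_le_norm_le_rpow`). Integration in x and Minkowski's inequality bound the jump set by a
constant times T^{1/(p-1)}, up to powers of δ, where T is the amalgam tail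
(`IsQuasiPeriodic.squareMeasure_jump_le`). Jumps in x are treated in the same way through e^{2πixy}
conj G, the Zak transform of conj ĝ.

As p/q = p - 1, two tails of size at most C (RL)^{-(p-1)} would give jump sets of total measure less
than 1/(m²RL), a contradiction. For p = 1 small tails make the jump sets null. -/

/-! ### Characters and Fourier series on the unit interval -/

/-- The character `t ↦ e^{2πit}` of the real line. -/
noncomputable def unitExp (t : ℝ) : ℂ := Complex.exp (((2 * Real.pi * t : ℝ) : ℂ) * Complex.I)

theorem unitExp_add (s t : ℝ) : unitExp (s + t) = unitExp s * unitExp t := by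
  rw [unitExp, unitExp, unitExp, ← Complex.exp_add]; congr 1; push_cast; ring

@[simp] theorem norm_unitExp (t : ℝ) : ‖unitExp t‖ = 1 := Complex.norm_exp_ofReal_mul_I _

@[simp] theorem unitExp_zero : unitExp 0 = 1 := by simp [unitExp]

theorem unitExp_ne_zero (t : ℝ) : unitExp t ≠ 0 := Complex.exp_ne_zero _

@[simp] theorem unitExp_intCast (n : ℤ) : unitExp n = 1 := by
  rw [unitExp, Complex.exp_eq_one_iff]; exact ⟨n, by push_cast; ring⟩

theorem unitExp_add_intCast (t : ℝ) (n : ℤ) : unitExp (t + n) = unitExp t := by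
  rw [unitExp_add, unitExp_intCast, mul_one]

theorem unitExp_neg_mul_self (t : ℝ) : unitExp (-t) * unitExp t = 1 := by
  rw [← unitExp_add, neg_add_cancel, unitExp_zero]

theorem conj_unitExp (t : ℝ) : starRingEnd ℂ (unitExp t) = unitExp (-t) := by
  rw [unitExp, unitExp, ← Complex.exp_conj, map_mul, Complex.conj_ofReal, Complex.conj_I]
  congr 1; push_cast; ring

@[fun_prop] theorem continuous_unitExp : Continuous unitExp := by unfold unitExp; fun_prop

@[fun_prop] theorem measurable_unitExp : Measurable unitExp := continuous_unitExp.measurable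

theorem norm_unitExp_sub_one_le (t : ℝ) : ‖unitExp t - 1‖ ≤ 2 * Real.pi * |t| := by
  have h := Real.norm_exp_I_mul_ofReal_sub_one_le (x := 2 * Real.pi * t)
  rw [mul_comm Complex.I] at h
  refine h.trans (le_of_eq ?_)
  rw [Real.norm_eq_abs, abs_mul, abs_of_pos Real.two_pi_pos]

theorem norm_unitExp_sub_one_le_two (t : ℝ) : ‖unitExp t - 1‖ ≤ 2 :=
  (norm_sub_le _ _).trans (by simp; norm_num)

/-- Lebesgue measure on the unit interval `(0, 1]`. -/
noncomputable abbrev unitMeasure : Measure ℝ := volume.restrict (Set.Ioc (0 : ℝ) 1)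

instance : IsProbabilityMeasure unitMeasure := ⟨by simp [unitMeasure]⟩

/-- The coefficient of `e^{-2πiky}` in the Fourier series of `f` on the unit interval. -/
noncomputable def expCoeff (f : ℝ → ℂ) (k : ℤ) : ℂ := ∫ y, unitExp (k * y) * f y ∂unitMeasure

theorem integral_unitExp_intCast_mul (k : ℤ) :
    ∫ y, unitExp (k * y) ∂unitMeasure = if k = 0 then 1 else 0 := by
  split_ifs with h
  · simp [h]
  · rw [← intervalIntegral.integral_of_le zero_le_one]
    have hc : (2 * Real.pi * Complex.I * k : ℂ) ≠ 0 := by simp [h, Real.pi_ne_zero]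
    have : ∀ y : ℝ, unitExp (k * y) = Complex.exp ((2 * Real.pi * Complex.I * k : ℂ) * y) := by
      intro y; rw [unitExp]; congr 1; push_cast; ring
    simp_rw [this]
    rw [integral_exp_mul_complex hc]
    have : (2 * Real.pi * Complex.I * k : ℂ) = k * (2 * Real.pi * Complex.I) := by ring
    simp [this, Complex.exp_int_mul_two_pi_mul_I]

theorem hasSum_sq_norm_expCoeff {f : ℝ → ℂ} (hf : MemLp f 2 unitMeasure) :
    HasSum (fun k : ℤ => ‖expCoeff f k‖ ^ 2) (∫ y, ‖f y‖ ^ 2 ∂unitMeasure) := by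
  have h := hasSum_sq_fourierCoeffOn (zero_lt_one (α := ℝ)) hf
  -- `expCoeff f k` is the usual Fourier coefficient of index -k.
  rw [← (Equiv.neg ℤ).hasSum_iff] at h
  convert h using 1
  · ext k
    simp only [Function.comp_apply, Equiv.neg_apply, fourierCoeffOn_eq_integral, expCoeff]
    rw [intervalIntegral.integral_of_le zero_le_one]
    simp only [sub_zero, div_one, one_smul, neg_neg, smul_eq_mul]
    congr 2
    refine integral_congr_ae (Filter.Eventually.of_forall fun y => ?_)
    simp only [fourier_coe_apply]
    congr 1
    rw [unitExp]; congr 1; push_cast; ring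
  · rw [intervalIntegral.integral_of_le zero_le_one]; simp

theorem lintegral_enorm_sq_eq_ofReal {α : Type*} [MeasurableSpace α] {μ : Measure α} {f : α → ℂ}
    (hf : MemLp f 2 μ) : ∫⁻ y, ‖f y‖ₑ ^ 2 ∂μ = ENNReal.ofReal (∫ y, ‖f y‖ ^ 2 ∂μ) := by
  rw [ofReal_integral_eq_lintegral_ofReal (hf.integrable_norm_pow two_ne_zero)
    (Filter.Eventually.of_forall fun y => by positivity)]
  refine lintegral_congr fun y => ?_
  rw [ENNReal.ofReal_pow (norm_nonneg _), ofReal_norm]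

theorem tsum_enorm_sq_expCoeff {f : ℝ → ℂ} (hf : MemLp f 2 unitMeasure) :
    ∑' k : ℤ, ‖expCoeff f k‖ₑ ^ 2 = ∫⁻ y, ‖f y‖ₑ ^ 2 ∂unitMeasure := by
  have h := hasSum_sq_norm_expCoeff hf
  rw [lintegral_enorm_sq_eq_ofReal hf, ← h.tsum_eq,
    ENNReal.ofReal_tsum_of_nonneg (fun _ => by positivity) h.summable]
  refine tsum_congr fun k => ?_
  rw [ENNReal.ofReal_pow (norm_nonneg _), ofReal_norm]

theorem integrable_unitExp_mul {f : ℝ → ℂ} (hf : Integrable f unitMeasure) (k : ℝ) :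
    Integrable (fun y => unitExp (k * y) * f y) unitMeasure := by
  refine hf.bdd_mul (c := 1) (Continuous.aestronglyMeasurable (by fun_prop))
    (Filter.Eventually.of_forall fun y => by simp)

theorem expCoeff_sub {f g : ℝ → ℂ} (hf : Integrable f unitMeasure) (hg : Integrable g unitMeasure)
    (k : ℤ) : expCoeff (fun y => f y - g y) k = expCoeff f k - expCoeff g k := by
  simp only [expCoeff, mul_sub]
  exact integral_sub (integrable_unitExp_mul hf k) (integrable_unitExp_mul hg k)

theorem memLp_expSum {ι : Type*} (s : Finset ι) (c : ι → ℂ) (n : ι → ℝ) (p : ℝ≥0∞) :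
    MemLp (fun y => ∑ i ∈ s, c i * unitExp (n i * y)) p unitMeasure := by
  refine MemLp.of_bound (Continuous.aestronglyMeasurable (by fun_prop)) (∑ i ∈ s, ‖c i‖)
    (Filter.Eventually.of_forall fun y => (norm_sum_le _ _).trans (by simp))

theorem integrable_expSum {ι : Type*} (s : Finset ι) (c : ι → ℂ) (n : ι → ℝ) :
    Integrable (fun y => ∑ i ∈ s, c i * unitExp (n i * y)) unitMeasure :=
  memLp_one_iff_integrable.1 (memLp_expSum s c n 1)

/-- Orthogonality of characters. Repeated frequencies are allowed because the de la Vallée Poussin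
double sum has them. -/
theorem expCoeff_expSum {ι : Type*} (s : Finset ι) (c : ι → ℂ) (n : ι → ℤ) (k : ℤ) :
    expCoeff (fun y => ∑ i ∈ s, c i * unitExp (-(n i : ℝ) * y)) k =
      ∑ i ∈ s, if n i = k then c i else 0 := by
  simp only [expCoeff, Finset.mul_sum]
  rw [integral_finsetSum]
  · refine Finset.sum_congr rfl fun i _ => ?_
    have : ∀ y : ℝ, unitExp (k * y) * (c i * unitExp (-(n i : ℝ) * y)) =
        c i * unitExp (((k - n i : ℤ) : ℝ) * y) := by
      intro y
      rw [mul_left_comm, ← unitExp_add]; congr 2; push_cast; ring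
    simp_rw [this]
    rw [integral_const_mul, integral_unitExp_intCast_mul]
    simp [sub_eq_zero, eq_comm]
  · intro i _
    exact integrable_unitExp_mul (by simpa using integrable_expSum {i} c (fun i => -(n i : ℝ))) k

theorem lintegral_enorm_sq_expSum {ι : Type*} (s : Finset ι) (c : ι → ℂ) {n : ι → ℤ}
    (hn : Function.Injective n) :
    ∫⁻ y, ‖∑ i ∈ s, c i * unitExp (-(n i : ℝ) * y)‖ₑ ^ 2 ∂unitMeasure = ∑ i ∈ s, ‖c i‖ₑ ^ 2 := by
  classical
  rw [← tsum_enorm_sq_expCoeff (memLp_expSum s c (fun i => -(n i : ℝ)) 2)]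
  simp only [expCoeff_expSum s c n]
  rw [tsum_eq_sum (s := s.image n), Finset.sum_image hn.injOn]
  · refine Finset.sum_congr rfl fun i hi => ?_
    simp [hn.eq_iff, hi]
  · intro k hk
    rw [Finset.sum_eq_zero]
    · simp
    · intro i hi
      rw [if_neg]
      rintro rfl
      exact hk (Finset.mem_image_of_mem n hi)

/-! ### Level sets controlled by Fourier coefficients -/

/-- The partial sum over `K` is at most η/2 everywhere, so on the level set the remainder is at
least η/2. Chebyshev's inequality in L² and Parseval then bound the measure. -/
theorem unitMeasure_le_norm_le {F : ℝ → ℂ} (hF : MemLp F 2 unitMeasure) {η : ℝ} (hη : 0 < η)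
    (K : Finset ℤ) (hK : ∑ k ∈ K, ‖expCoeff F k‖ ≤ η / 2) :
    unitMeasure {y | η ≤ ‖F y‖} ≤
      ENNReal.ofReal (4 / η ^ 2) * ∑' k : {k // k ∉ K}, ‖expCoeff F k‖ₑ ^ 2 := by
  set P : ℝ → ℂ := fun y => ∑ k ∈ K, expCoeff F k * unitExp (-(k : ℝ) * y) with hP
  have hPm : MemLp P 2 unitMeasure := memLp_expSum K (expCoeff F) (fun k => -(k : ℝ)) 2
  have hD : MemLp (fun y => F y - P y) 2 unitMeasure := hF.sub hPm
  have hcoef : ∀ k, expCoeff (fun y => F y - P y) k = if k ∈ K then 0 else expCoeff F k := by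
    intro k
    rw [expCoeff_sub (hF.integrable one_le_two) (hPm.integrable one_le_two),
      expCoeff_expSum K (expCoeff F) (fun n => n)]
    by_cases hk : k ∈ K <;> simp [hk]
  have hsub : {y | η ≤ ‖F y‖} ⊆ {y | ENNReal.ofReal (η ^ 2 / 4) ≤ ‖F y - P y‖ₑ ^ 2} := by
    intro y hy
    simp only [Set.mem_ofPred_eq] at hy ⊢
    rw [← ofReal_norm, ← ENNReal.ofReal_pow (norm_nonneg _)]
    refine ENNReal.ofReal_le_ofReal ?_
    have h1 : ‖P y‖ ≤ η / 2 := (norm_sum_le _ _).trans (by simpa using hK)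
    have h2 : η / 2 ≤ ‖F y - P y‖ := by linarith [norm_sub_norm_le (F y) (P y)]
    calc η ^ 2 / 4 = (η / 2) ^ 2 := by ring
      _ ≤ _ := by gcongr
  refine (measure_mono hsub).trans ((meas_ge_le_lintegral_div ?_ ?_ ENNReal.ofReal_ne_top).trans ?_)
  · exact hD.aestronglyMeasurable.enorm.pow_const 2
  · simp; positivity
  · rw [← tsum_enorm_sq_expCoeff hD, ENNReal.div_eq_inv_mul,
      ← ENNReal.ofReal_inv_of_pos (by positivity), inv_div]
    gcongr
    refine le_trans (le_of_eq (tsum_congr fun k => ?_))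
      (tsum_subtype {k | k ∉ K} fun k => ‖expCoeff F k‖ₑ ^ 2).ge
    by_cases hk : k ∈ K <;> simp [hcoef, hk]

/-- Every finite `K` is admissible in the previous bound, and the square sum outside `K` tends to 0.
-/
theorem unitMeasure_le_norm_eq_zero {F : ℝ → ℂ} (hF : MemLp F 2 unitMeasure) {η : ℝ} (hη : 0 < η)
    (h : ∑' k, ‖expCoeff F k‖ₑ ≤ ENNReal.ofReal (η / 2)) :
    unitMeasure {y | η ≤ ‖F y‖} = 0 := by
  have htop : ∑' k, ‖expCoeff F k‖ₑ ^ 2 ≠ ∞ := by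
    rw [tsum_enorm_sq_expCoeff hF, lintegral_enorm_sq_eq_ofReal hF]
    exact ENNReal.ofReal_ne_top
  have ht := ENNReal.Tendsto.const_mul (a := ENNReal.ofReal (4 / η ^ 2))
    (ENNReal.tendsto_tsum_compl_atTop_zero htop) (Or.inr ENNReal.ofReal_ne_top)
  rw [mul_zero] at ht
  refine le_antisymm (ge_of_tendsto' ht fun K => unitMeasure_le_norm_le hF hη K ?_) zero_le
  rw [← ENNReal.ofReal_le_ofReal_iff (by positivity),
    ENNReal.ofReal_sum_of_nonneg fun _ _ => norm_nonneg _]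
  simp only [ofReal_norm]
  exact (ENNReal.sum_le_tsum K).trans h

/-- Interpolation by truncation: coefficients above a height l are removed and summed in ℓ¹, the
others are summed in ℓ², and l is chosen so that the removed ones just fit into η/2. -/
theorem unitMeasure_le_norm_le_rpow {F : ℝ → ℂ} (hF : MemLp F 2 unitMeasure) {η : ℝ} (hη : 0 < η)
    {p : ℝ} (hp1 : 1 < p) (hp2 : p ≤ 2) :
    unitMeasure {y | η ≤ ‖F y‖} ≤ ENNReal.ofReal (2 / η) *
      (ENNReal.ofReal (2 / η) * ∑' k, ‖expCoeff F k‖ₑ ^ p) ^ (1 / (p - 1)) := by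
  set b := expCoeff F
  have hr : 0 < 1 / (p - 1) := one_div_pos.2 (sub_pos.2 hp1)
  have hη2 : 0 < 2 / η := by positivity
  set S := ∑' k, ‖b k‖ₑ ^ p with hS
  rcases eq_or_ne S ∞ with hSt | hSt
  · rw [hSt, ENNReal.mul_top (by simpa using hη), ENNReal.top_rpow_of_pos hr,
      ENNReal.mul_top (by simpa using hη)]
    exact le_top
  rcases eq_or_ne S 0 with hS0 | hS0
  · have hb : ∀ k, b k = 0 := fun k => by
      have := ENNReal.tsum_eq_zero.1 hS0 k
      simpa [show 0 < p by linarith, show ¬ p < 0 by linarith] using this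
    refine (unitMeasure_le_norm_le hF hη ∅ (by simp; positivity)).trans ?_
    have : ∀ k : {k // k ∉ (∅ : Finset ℤ)}, ‖expCoeff F k‖ₑ ^ 2 = 0 := fun k => by
      simp [show expCoeff F k = 0 from hb k]
    simp [this]
  have hs : 0 < S.toReal := ENNReal.toReal_pos hS0 hSt
  have hSs : S = ENNReal.ofReal S.toReal := (ENNReal.ofReal_toReal hSt).symm
  set s := S.toReal
  have hpow : ∀ k, ‖b k‖ₑ ^ p = ENNReal.ofReal (‖b k‖ ^ p) := fun k => by
    rw [← ENNReal.ofReal_rpow_of_nonneg (norm_nonneg _) (by linarith), ofReal_norm]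
  have hsum : Summable fun k => ‖b k‖ ^ p := by
    have := ENNReal.summable_toReal (f := fun k => ‖b k‖ₑ ^ p) hSt
    refine this.congr fun k => ?_
    rw [hpow, ENNReal.toReal_ofReal (by positivity)]
  have hsums : ∑' k, ‖b k‖ ^ p = s := by
    have h : S = ENNReal.ofReal (∑' k, ‖b k‖ ^ p) := by
      rw [ENNReal.ofReal_tsum_of_nonneg (fun _ => by positivity) hsum, hS]
      exact tsum_congr hpow
    rw [show s = S.toReal from rfl, h, ENNReal.toReal_ofReal (tsum_nonneg fun _ => by positivity)]
  -- The height solves l^{1-p} s = η/2, and l^{1-p} s bounds the ℓ¹ norm of the coefficients larger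
  -- than l.
  set l : ℝ := (2 / η * s) ^ (1 / (p - 1)) with hl
  have hl0 : 0 < l := by positivity
  have hlp : l ^ (p - 1) = 2 / η * s := by
    rw [hl, ← Real.rpow_mul (by positivity), one_div, inv_mul_cancel₀ (by linarith), Real.rpow_one]
  have hfin : {k | l ^ p < ‖b k‖ ^ p}.Finite := by
    have := hsum.tendsto_cofinite_zero.eventually (gt_mem_nhds (Real.rpow_pos_of_pos hl0 p))
    refine Set.Finite.subset this fun k hk => ?_
    simpa using le_of_lt hk
  have hmem : ∀ k, k ∈ hfin.toFinset ↔ l < ‖b k‖ := fun k => by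
    rw [Set.Finite.mem_toFinset, Set.mem_ofPred_eq,
      Real.rpow_lt_rpow_iff hl0.le (norm_nonneg _) (by linarith)]
  refine (unitMeasure_le_norm_le hF hη hfin.toFinset ?_).trans ?_
  · have h1 : ∀ k ∈ hfin.toFinset, ‖b k‖ ≤ (l ^ (p - 1))⁻¹ * ‖b k‖ ^ p := by
      intro k hk
      have hk' := (hmem k).1 hk
      have hb0 : 0 < ‖b k‖ := hl0.trans hk'
      rw [inv_mul_eq_div, le_div_iff₀ (by positivity)]
      calc ‖b k‖ * l ^ (p - 1) ≤ ‖b k‖ * ‖b k‖ ^ (p - 1) := by gcongr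
        _ = ‖b k‖ ^ p := by
          rw [← Real.rpow_one_add' hb0.le (by linarith)]; congr 1; ring
    refine (Finset.sum_le_sum h1).trans ?_
    rw [← Finset.mul_sum, hlp]
    refine (mul_le_mul_of_nonneg_left
      (hsum.sum_le_tsum _ fun k _ => by positivity) (by positivity)).trans ?_
    rw [hsums]
    apply le_of_eq; field_simp
  -- Below the height, |b|² ≤ l^{2-p} |b|^p, which needs p ≤ 2. The final bound 4/η² · l^{2-p} s
  -- then equals (2/η) l.
  · have h2 : ∑' k : {k // k ∉ hfin.toFinset}, ‖b k‖ₑ ^ 2 ≤ ENNReal.ofReal (l ^ (2 - p)) * S := by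
      calc ∑' k : {k // k ∉ hfin.toFinset}, ‖b k‖ₑ ^ 2
          ≤ ∑' k : {k // k ∉ hfin.toFinset}, ENNReal.ofReal (l ^ (2 - p)) * ‖b k‖ₑ ^ p := by
            refine ENNReal.tsum_le_tsum fun k => ?_
            have hk := k.2
            rw [hmem, not_lt] at hk
            rw [hpow, ← ENNReal.ofReal_mul (by positivity), ← ofReal_norm,
              ← ENNReal.ofReal_pow (norm_nonneg _)]
            refine ENNReal.ofReal_le_ofReal ?_
            calc ‖b k‖ ^ 2 = ‖b k‖ ^ (2 - p) * ‖b k‖ ^ p := by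
                  rw [← Real.rpow_add' (norm_nonneg _) (by norm_num)]
                  norm_num
              _ ≤ _ := by gcongr
        _ = ENNReal.ofReal (l ^ (2 - p)) *
              ∑' k : {k // k ∉ hfin.toFinset}, ‖b k‖ₑ ^ p := ENNReal.tsum_mul_left
        _ ≤ _ := by
          gcongr
          exact ENNReal.tsum_comp_le_tsum_of_injective Subtype.val_injective (fun k => ‖b k‖ₑ ^ p)
    refine (mul_le_mul_right h2 _).trans ?_
    rw [hSs, ← ENNReal.ofReal_mul hη2.le, ENNReal.ofReal_rpow_of_nonneg (by positivity) hr.le,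
      ← ENNReal.ofReal_mul (by positivity), ← ENNReal.ofReal_mul (by positivity),
      ← ENNReal.ofReal_mul (by positivity), ← hl]
    refine ENNReal.ofReal_le_ofReal (le_of_eq ?_)
    have h3 : l ^ (2 - p) * l ^ (p - 1) = l := by
      rw [← Real.rpow_add hl0]; norm_num
    rw [hlp] at h3
    calc _ = 2 / η * (l ^ (2 - p) * (2 / η * s)) := by ring
      _ = _ := by rw [h3]

/-! ### Translates of periodic functions and L² norms of exponential sums -/

theorem unitExp_mul_sub_one_mul (a b c : ℝ) :
    unitExp a * (unitExp b - 1) * unitExp c = unitExp (a + b + c) - unitExp (a + c) := by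
  simp only [unitExp_add]; ring

theorem lintegral_unit_eq_of_periodic {f : ℝ → ℝ≥0∞} (hf : Function.Periodic f 1) (t : ℝ) :
    ∫⁻ y, f (y + t) ∂unitMeasure = ∫⁻ y, f y ∂unitMeasure := by
  have h1 : ∫⁻ y, f (y + t) ∂unitMeasure = ∫⁻ y in Set.Ioc t (t + 1), f y := by
    rw [(measurePreserving_add_right volume t).setLIntegral_comp_emb
      (measurableEmbedding_addRight t) f (Set.Ioc 0 1)]
    simp [add_comm]
  rw [h1]
  have h0 := isAddFundamentalDomain_Ioc (zero_lt_one (α := ℝ)) 0 volume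
  have ht := isAddFundamentalDomain_Ioc (zero_lt_one (α := ℝ)) t volume
  rw [zero_add] at h0
  refine ht.setLIntegral_eq h0 f ?_
  rintro ⟨g, hg⟩ x
  obtain ⟨n, rfl⟩ := AddSubgroup.mem_zmultiples_iff.1 hg
  change f (n • (1 : ℝ) + x) = f x
  rw [add_comm]
  exact (hf.zsmul n) x

theorem integral_unit_eq_of_periodic {f : ℝ → ℂ} (hf : Function.Periodic f 1) (t : ℝ) :
    ∫ y, f (y + t) ∂unitMeasure = ∫ y, f y ∂unitMeasure := by
  rw [← intervalIntegral.integral_of_le zero_le_one, ← intervalIntegral.integral_of_le zero_le_one,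
    intervalIntegral.integral_comp_add_right]
  simpa [add_comm] using hf.intervalIntegral_add_eq t 0

theorem ae_add_of_ae_of_periodic {P : ℝ → Prop} (hP : ∀ x, P (x + 1) ↔ P x)
    (h : ∀ᵐ y ∂unitMeasure, P y) : ∀ᵐ y, P y := by
  have hz : ∀ (n : ℤ) x, P (x + n) ↔ P x := by
    have : Function.Periodic P 1 := fun x => propext (hP x)
    intro n x
    simpa using (this.zsmul n) x
  have h1 : ∀ᵐ y : ℝ, y ∈ Set.Ioc (0 : ℝ) 1 → P y := (ae_restrict_iff' measurableSet_Ioc).1 h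
  have h2 : ∀ᵐ y : ℝ, ∀ n : ℤ, y + n ∈ Set.Ioc (0 : ℝ) 1 → P (y + n) := by
    rw [ae_all_iff]
    intro n
    exact (measurePreserving_add_right volume (n : ℝ)).quasiMeasurePreserving.ae h1
  filter_upwards [h2] with y hy
  refine (hz (1 - ⌈y⌉) y).1 (hy _ ⟨?_, ?_⟩)
  · push_cast; linarith [Int.ceil_lt_add_one y]
  · push_cast; linarith [Int.le_ceil y]

theorem expCoeff_translate {f : ℝ → ℂ} (hf : Function.Periodic f 1) (s : ℝ) (k : ℤ) :
    expCoeff (fun y => f (y + s)) k = unitExp (-(k * s)) * expCoeff f k := by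
  rw [expCoeff, expCoeff, ← integral_const_mul]
  rw [← integral_unit_eq_of_periodic (f := fun y => unitExp (-(k * s)) * (unitExp (k * y) * f y)) _ s]
  · refine integral_congr_ae (Filter.Eventually.of_forall fun y => ?_)
    simp only
    rw [← mul_assoc, ← unitExp_add]
    congr 2; ring
  · intro y
    simp only [hf y, mul_add, mul_one, unitExp_add_intCast]

theorem lintegral_mul_le_sqrt (f g : ℝ → ℂ) (hf : Continuous f) (hg : Continuous g) :
    ∫⁻ y, ‖f y‖ₑ * ‖g y‖ₑ ∂unitMeasure ≤
      (∫⁻ y, ‖f y‖ₑ ^ 2 ∂unitMeasure) ^ (1 / 2 : ℝ) *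
        (∫⁻ y, ‖g y‖ₑ ^ 2 ∂unitMeasure) ^ (1 / 2 : ℝ) := by
  have := ENNReal.lintegral_mul_le_Lp_mul_Lq unitMeasure Real.HolderConjugate.two_two
    (f := fun y => ‖f y‖ₑ) (g := fun y => ‖g y‖ₑ) hf.enorm.aemeasurable hg.enorm.aemeasurable
  simpa using this

theorem lintegral_enorm_sq_expSum_le {ι : Type*} (s : Finset ι) (c : ι → ℂ) {n : ι → ℤ}
    (hn : Function.Injective n) {C : ℝ} (hC : 0 ≤ C) (hc : ∀ n ∈ s, ‖c n‖ ≤ C) :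
    (∫⁻ y, ‖∑ i ∈ s, c i * unitExp (-(n i : ℝ) * y)‖ₑ ^ 2 ∂unitMeasure) ^ (1 / 2 : ℝ) ≤
      ENNReal.ofReal (√s.card * C) := by
  rw [lintegral_enorm_sq_expSum s c hn]
  have : ∑ n ∈ s, ‖c n‖ₑ ^ 2 ≤ ENNReal.ofReal ((√s.card * C) ^ 2) := by
    calc ∑ n ∈ s, ‖c n‖ₑ ^ 2 ≤ ∑ n ∈ s, ENNReal.ofReal (C ^ 2) := by
          refine Finset.sum_le_sum fun n hn => ?_
          rw [← ofReal_norm, ← ENNReal.ofReal_pow (norm_nonneg _)]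
          gcongr
          exact hc n hn
      _ = _ := by
          rw [Finset.sum_const, nsmul_eq_mul, mul_pow, Real.sq_sqrt (by positivity),
            ENNReal.ofReal_mul (by positivity), ENNReal.ofReal_natCast]
  calc _ ≤ (ENNReal.ofReal ((√s.card * C) ^ 2)) ^ (1 / 2 : ℝ) := by gcongr
    _ = _ := by
      rw [ENNReal.ofReal_rpow_of_nonneg (by positivity) (by norm_num), ← Real.sqrt_eq_rpow,
        Real.sqrt_sq (by positivity)]

/-! ### Low and high frequencies of a difference f(· + s) - f -/

/-- The multiplier of a de la Vallée Poussin mean: it is `1` for `|m| ≤ N` and lies in `[0, 1]`. -/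
noncomputable def vallePoussinWeight (N : ℕ) (m : ℤ) : ℝ :=
  (∑ j ∈ Finset.range N, if m + j ∈ Finset.Ico (-(N : ℤ)) (2 * N) then 1 else 0) / N

theorem vallePoussinWeight_nonneg (N : ℕ) (m : ℤ) : 0 ≤ vallePoussinWeight N m :=
  div_nonneg (Finset.sum_nonneg fun _ _ => by split_ifs <;> norm_num) (by positivity)

theorem vallePoussinWeight_le_one {N : ℕ} (hN : 0 < N) (m : ℤ) : vallePoussinWeight N m ≤ 1 := by
  rw [vallePoussinWeight, div_le_one (by positivity)]
  calc _ ≤ ∑ j ∈ Finset.range N, (1 : ℝ) := Finset.sum_le_sum fun _ _ => by split_ifs <;> norm_num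
    _ = _ := by simp

/-- For |m| ≤ N and 0 ≤ j < N the number m + j runs exactly through the window [-N, 2N), so every
term of the average counts. -/
theorem vallePoussinWeight_eq_one {N : ℕ} (hN : 0 < N) {m : ℤ} (hm : |m| ≤ N) :
    vallePoussinWeight N m = 1 := by
  rw [vallePoussinWeight, div_eq_one_iff_eq (by positivity), Finset.sum_congr rfl (g := fun _ => 1)]
  · simp
  · intro j hj
    rw [if_pos]
    rw [Finset.mem_range] at hj
    rw [abs_le] at hm
    rw [Finset.mem_Ico]
    omega

/-- The low-frequency part of the difference `f (· + s) - f`. -/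
noncomputable def lowDiff (f : ℝ → ℂ) (N : ℕ) (s y : ℝ) : ℂ :=
  ∑ i ∈ Finset.range N ×ˢ Finset.Ico (-(N : ℤ)) (2 * N),
    ((N : ℂ)⁻¹ * ((unitExp (-(((i.2 - i.1 : ℤ) : ℝ) * s)) - 1) * expCoeff f (i.2 - i.1))) *
      unitExp (-((i.2 - i.1 : ℤ) : ℝ) * y)

theorem expCoeff_lowDiff (f : ℝ → ℂ) (N : ℕ) (s : ℝ) (m : ℤ) :
    expCoeff (lowDiff f N s) m =
      vallePoussinWeight N m * ((unitExp (-(m * s)) - 1) * expCoeff f m) := by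
  unfold lowDiff
  rw [expCoeff_expSum _ _ (fun i : ℕ × ℤ => i.2 - i.1), Finset.sum_product]
  have : ∀ j ∈ Finset.range N, (∑ l ∈ Finset.Ico (-(N : ℤ)) (2 * N), if l - (j : ℤ) = m then
      (N : ℂ)⁻¹ * ((unitExp (-(((l - j : ℤ) : ℝ) * s)) - 1) * expCoeff f (l - j)) else 0) =
      (if m + j ∈ Finset.Ico (-(N : ℤ)) (2 * N) then 1 else 0) *
        ((N : ℂ)⁻¹ * ((unitExp (-(m * s)) - 1) * expCoeff f m)) := by
    intro j _
    simp only [sub_eq_iff_eq_add]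
    rw [Finset.sum_ite_eq']
    split_ifs <;> simp
  simp only
  rw [Finset.sum_congr rfl this, ← Finset.sum_mul, vallePoussinWeight]
  simp only [Complex.ofReal_div, Complex.ofReal_sum, apply_ite Complex.ofReal, Complex.ofReal_one,
    Complex.ofReal_zero, Complex.ofReal_natCast]
  ring

/-- The double sum over (j, l) makes the convolution kernel a product of two Dirichlet-type sums
divided by N. This product form is what gives Cauchy–Schwarz a bound without a logarithm. -/
theorem lowDiff_eq_integral {f : ℝ → ℂ} (hf : Integrable f unitMeasure) (N : ℕ) (s y : ℝ) :
    lowDiff f N s y = ∫ z, (N : ℂ)⁻¹ *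
      ((∑ j ∈ Finset.range N, unitExp (-((j : ℝ) * (z - (y + s))))) *
        (∑ l ∈ Finset.Ico (-(N : ℤ)) (2 * N), unitExp (l * (z - (y + s)))) -
      (∑ j ∈ Finset.range N, unitExp (-((j : ℝ) * (z - y)))) *
        (∑ l ∈ Finset.Ico (-(N : ℤ)) (2 * N), unitExp (l * (z - y)))) * f z ∂unitMeasure := by
  have key : ∀ z, (N : ℂ)⁻¹ *
      ((∑ j ∈ Finset.range N, unitExp (-((j : ℝ) * (z - (y + s))))) *
        (∑ l ∈ Finset.Ico (-(N : ℤ)) (2 * N), unitExp (l * (z - (y + s)))) -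
      (∑ j ∈ Finset.range N, unitExp (-((j : ℝ) * (z - y)))) *
        (∑ l ∈ Finset.Ico (-(N : ℤ)) (2 * N), unitExp (l * (z - y)))) * f z =
      ∑ i ∈ Finset.range N ×ˢ Finset.Ico (-(N : ℤ)) (2 * N),
        ((N : ℂ)⁻¹ * (unitExp (-(((i.2 - i.1 : ℤ) : ℝ) * s)) - 1) *
          unitExp (-((i.2 - i.1 : ℤ) : ℝ) * y)) * (unitExp (((i.2 - i.1 : ℤ) : ℝ) * z) * f z) := by
    intro z
    rw [Finset.sum_mul_sum, Finset.sum_mul_sum, ← Finset.sum_product', ← Finset.sum_product',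
      ← Finset.sum_sub_distrib, Finset.mul_sum, Finset.sum_mul]
    refine Finset.sum_congr rfl fun i _ => ?_
    rw [← unitExp_add, ← unitExp_add]
    have h1 : -((i.1 : ℝ) * (z - (y + s))) + i.2 * (z - (y + s)) =
      -(((i.2 - i.1 : ℤ) : ℝ) * s) + -((i.2 - i.1 : ℤ) : ℝ) * y + ((i.2 - i.1 : ℤ) : ℝ) * z := by
      push_cast; ring
    have h2 : -((i.1 : ℝ) * (z - y)) + i.2 * (z - y) =
      -((i.2 - i.1 : ℤ) : ℝ) * y + ((i.2 - i.1 : ℤ) : ℝ) * z := by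
      push_cast; ring
    rw [h1, h2]
    simp only [unitExp_add]
    ring
  simp_rw [key]
  rw [integral_finsetSum]
  · refine Finset.sum_congr rfl fun i _ => ?_
    rw [integral_const_mul, expCoeff]
    ring
  · intro i _
    exact (integrable_unitExp_mul hf _).const_mul _

/-- A Bernstein inequality. With D and E the two factors of the kernel at y, and D', E' those at y +
s, D'E' - DE = (D' - D)E' + D(E' - E). Cauchy–Schwarz and Parseval bound the L¹ norm of each
product: each factor has norm of order √N, and a difference gains a further factor of order Ns. -/
theorem norm_lowDiff_le {f : ℝ → ℂ} (hf : Integrable f unitMeasure) {β : ℝ} (hβ : 0 ≤ β)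
    (hb : ∀ᵐ y ∂unitMeasure, ‖f y‖ ≤ β) {N : ℕ} (hN : 0 < N) {s : ℝ} (hs : 0 ≤ s) (y : ℝ) :
    ‖lowDiff f N s y‖ ≤ 40 * β * N * s := by
  set D : ℝ → ℝ → ℂ := fun w z => ∑ j ∈ Finset.range N, unitExp (-((j : ℝ) * (z - w))) with hD
  set E : ℝ → ℝ → ℂ := fun w z =>
    ∑ l ∈ Finset.Ico (-(N : ℤ)) (2 * N), unitExp (l * (z - w)) with hE
  have hDc : ∀ w, Continuous (D w) := fun w => by simp only [hD]; fun_prop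
  have hEc : ∀ w, Continuous (E w) := fun w => by simp only [hE]; fun_prop
  have hinjE : Function.Injective (fun l : ℤ => -l) := neg_injective
  -- There are 3N frequencies; 4N is used only because its square root is 2√N.
  have hcardE : ((Finset.Ico (-(N : ℤ)) (2 * N)).card : ℝ) ≤ 4 * N := by
    rw [Int.card_Ico]
    have : ((2 * (N : ℤ) - -N).toNat) = 3 * N := by omega
    rw [this]; push_cast; nlinarith [Nat.cast_nonneg (α := ℝ) N]
  have hsqE : √((Finset.Ico (-(N : ℤ)) (2 * N)).card : ℝ) ≤ 2 * √N := by
    calc _ ≤ √(4 * N : ℝ) := Real.sqrt_le_sqrt hcardE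
      _ = 2 * √N := by
        rw [Real.sqrt_mul (by norm_num), show (4 : ℝ) = 2 ^ 2 by norm_num,
          Real.sqrt_sq (by norm_num)]
  have d1 : ∀ w, (∫⁻ z, ‖D w z‖ₑ ^ 2 ∂unitMeasure) ^ (1 / 2 : ℝ) ≤ ENNReal.ofReal √N := by
    intro w
    have := lintegral_enorm_sq_expSum_le (Finset.range N) (fun j => unitExp (j * w))
      (n := fun j => (j : ℤ)) Nat.cast_injective zero_le_one (by simp)
    rw [Finset.card_range, mul_one] at this
    convert this using 6 with z
    refine Finset.sum_congr rfl fun j _ => ?_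
    rw [← unitExp_add]; congr 1; push_cast; ring
  have d2 : (∫⁻ z, ‖D (y + s) z - D y z‖ₑ ^ 2 ∂unitMeasure) ^ (1 / 2 : ℝ) ≤
      ENNReal.ofReal (√N * (2 * Real.pi * (N * s))) := by
    have := lintegral_enorm_sq_expSum_le (Finset.range N)
      (fun j => unitExp (j * y) * (unitExp (j * s) - 1))
      (n := fun j => (j : ℤ)) Nat.cast_injective (C := 2 * Real.pi * (N * s)) (by positivity) ?_
    · rw [Finset.card_range] at this
      convert this using 6 with z
      rw [hD, ← Finset.sum_sub_distrib]
      refine Finset.sum_congr rfl fun j _ => ?_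
      rw [unitExp_mul_sub_one_mul]
      congr 2 <;> push_cast <;> ring
    · intro j hj
      rw [norm_mul, norm_unitExp, one_mul]
      refine (norm_unitExp_sub_one_le _).trans ?_
      rw [abs_of_nonneg (by positivity)]
      have : (j : ℝ) ≤ N := by exact_mod_cast (Finset.mem_range.1 hj).le
      gcongr
  have e1 : ∀ w, (∫⁻ z, ‖E w z‖ₑ ^ 2 ∂unitMeasure) ^ (1 / 2 : ℝ) ≤ ENNReal.ofReal (2 * √N) := by
    intro w
    have := lintegral_enorm_sq_expSum_le (Finset.Ico (-(N : ℤ)) (2 * N))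
      (fun l => unitExp (-(l * w))) hinjE zero_le_one (by simp)
    rw [mul_one] at this
    refine le_trans (le_of_eq ?_) (this.trans (ENNReal.ofReal_le_ofReal hsqE))
    congr 2 with z
    congr 2
    refine Finset.sum_congr rfl fun j _ => ?_
    rw [← unitExp_add]; congr 1; push_cast; ring
  have e2 : (∫⁻ z, ‖E (y + s) z - E y z‖ₑ ^ 2 ∂unitMeasure) ^ (1 / 2 : ℝ) ≤
      ENNReal.ofReal (2 * √N * (2 * Real.pi * (2 * N * s))) := by
    have := lintegral_enorm_sq_expSum_le (Finset.Ico (-(N : ℤ)) (2 * N))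
      (fun l => unitExp (-(l * y)) * (unitExp (-(l * s)) - 1)) hinjE
      (C := 2 * Real.pi * (2 * N * s)) (by positivity) ?_
    · refine le_trans (le_of_eq ?_) (this.trans (ENNReal.ofReal_le_ofReal (by gcongr)))
      congr 2 with z
      rw [hE, ← Finset.sum_sub_distrib]
      congr 2
      refine Finset.sum_congr rfl fun j _ => ?_
      rw [unitExp_mul_sub_one_mul]
      congr 2 <;> push_cast <;> ring
    · intro l hl
      rw [norm_mul, norm_unitExp, one_mul]
      refine (norm_unitExp_sub_one_le _).trans ?_
      rw [abs_neg, abs_mul, abs_of_nonneg hs]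
      rw [Finset.mem_Ico] at hl
      have : |(l : ℝ)| ≤ 2 * N := by
        rw [abs_le]; constructor
        · have : ((-(N : ℤ) : ℤ) : ℝ) ≤ l := by exact_mod_cast hl.1
          push_cast at this; linarith [Nat.cast_nonneg (α := ℝ) N]
        · have : (l : ℝ) ≤ ((2 * N : ℤ) : ℝ) := by exact_mod_cast hl.2.le
          push_cast at this; linarith
      gcongr
  have hprod : ∫⁻ z, ‖D (y + s) z * E (y + s) z - D y z * E y z‖ₑ ∂unitMeasure ≤
      ENNReal.ofReal (40 * N * N * s) := by
    calc _ ≤ ∫⁻ z, (‖D (y + s) z - D y z‖ₑ * ‖E (y + s) z‖ₑ +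
            ‖D y z‖ₑ * ‖E (y + s) z - E y z‖ₑ) ∂unitMeasure := by
          refine lintegral_mono fun z => ?_
          rw [← enorm_mul, ← enorm_mul]
          refine le_trans (le_of_eq ?_) (enorm_add_le _ _)
          congr 1; ring
      _ = _ := lintegral_add_left (by
          exact (((hDc _).sub (hDc _)).enorm.measurable).mul (hEc _).enorm.measurable) _
      _ ≤ ENNReal.ofReal (√N * (2 * Real.pi * (N * s))) * ENNReal.ofReal (2 * √N) +
          ENNReal.ofReal √N * ENNReal.ofReal (2 * √N * (2 * Real.pi * (2 * N * s))) := by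
          refine add_le_add ?_ ?_
          · refine (lintegral_mul_le_sqrt (fun z => D (y + s) z - D y z) (E (y + s))
              ((hDc _).sub (hDc _)) (hEc _)).trans ?_
            gcongr
            exact e1 _
          · refine (lintegral_mul_le_sqrt (D y) (fun z => E (y + s) z - E y z)
              (hDc _) ((hEc _).sub (hEc _))).trans ?_
            gcongr
            exact d1 _
      _ ≤ _ := by
          rw [← ENNReal.ofReal_mul (by positivity), ← ENNReal.ofReal_mul (by positivity),
            ← ENNReal.ofReal_add (by positivity) (by positivity)]
          refine ENNReal.ofReal_le_ofReal ?_
          have hsq : √(N : ℝ) * √N = N := Real.mul_self_sqrt (by positivity)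
          -- The two products contribute 4πN²s and 8πN²s, and 12π < 40.
          calc _ = (√(N : ℝ) * √N) * (12 * Real.pi * (N * s)) := by ring
            _ = N * (12 * Real.pi * (N * s)) := by rw [hsq]
            _ ≤ N * (12 * 3.1416 * (N * s)) := by
              gcongr; exact Real.pi_lt_d4.le
            _ ≤ _ := by nlinarith [show 0 ≤ (N : ℝ) * (N * s) by positivity]
  have hfin : ‖lowDiff f N s y‖ₑ ≤ ENNReal.ofReal (40 * β * N * s) := by
    rw [lowDiff_eq_integral hf]
    refine (enorm_integral_le_lintegral_enorm _).trans ?_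
    calc _ ≤ ∫⁻ z, ENNReal.ofReal ((N : ℝ)⁻¹ * β) *
            ‖D (y + s) z * E (y + s) z - D y z * E y z‖ₑ ∂unitMeasure := by
          refine lintegral_mono_ae ?_
          filter_upwards [hb] with z hz
          rw [enorm_mul, enorm_mul, ENNReal.ofReal_mul (by positivity), mul_assoc, mul_assoc,
            mul_comm ‖_ - _‖ₑ]
          have hNe : ‖(N : ℂ)⁻¹‖ₑ = ENNReal.ofReal (N : ℝ)⁻¹ := by
            rw [← ofReal_norm, norm_inv, Complex.norm_natCast]
          rw [hNe]
          gcongr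
          rw [← ofReal_norm]
          exact ENNReal.ofReal_le_ofReal hz
      _ = ENNReal.ofReal ((N : ℝ)⁻¹ * β) *
            ∫⁻ z, ‖D (y + s) z * E (y + s) z - D y z * E y z‖ₑ ∂unitMeasure :=
          lintegral_const_mul _
            ((((hDc _).mul (hEc _)).sub ((hDc _).mul (hEc _))).enorm.measurable)
      _ ≤ ENNReal.ofReal ((N : ℝ)⁻¹ * β) * ENNReal.ofReal (40 * N * N * s) := by gcongr
      _ = _ := by
          rw [← ENNReal.ofReal_mul (by positivity)]
          congr 1
          have : (N : ℝ) ≠ 0 := by positivity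
          field_simp
  rw [← ofReal_norm] at hfin
  exact (ENNReal.ofReal_le_ofReal_iff (by positivity)).1 hfin

theorem memLp_translate_of_periodic {f : ℝ → ℂ} (hf : Function.Periodic f 1) (hm : Measurable f)
    (h : MemLp f 2 unitMeasure) (s : ℝ) : MemLp (fun y => f (y + s)) 2 unitMeasure := by
  refine ⟨(hm.comp (measurable_id.add_const s)).aestronglyMeasurable, ?_⟩
  have h2 := h.2
  rw [eLpNorm_lt_top_iff_lintegral_rpow_enorm_lt_top two_ne_zero ENNReal.ofNat_ne_top] at h2 ⊢
  rwa [lintegral_unit_eq_of_periodic (f := fun y => ‖f y‖ₑ ^ (2 : ℝ≥0∞).toReal)]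
  intro y
  simp only [hf y]

theorem memLp_lowDiff (f : ℝ → ℂ) (N : ℕ) (s : ℝ) : MemLp (lowDiff f N s) 2 unitMeasure := by
  unfold lowDiff
  exact memLp_expSum _ _ (fun i : ℕ × ℤ => -((i.2 - i.1 : ℤ) : ℝ)) 2

/-- The high-frequency part of the difference `f (· + s) - f`. -/
noncomputable def highDiff (f : ℝ → ℂ) (N : ℕ) (s y : ℝ) : ℂ :=
  f (y + s) - f y - lowDiff f N s y

theorem memLp_highDiff {f : ℝ → ℂ} (hf : Function.Periodic f 1) (hm : Measurable f)
    (h : MemLp f 2 unitMeasure) {N : ℕ} (s : ℝ) :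
     MemLp (highDiff f N s) 2 unitMeasure :=
  ((memLp_translate_of_periodic hf hm h s).sub h).sub (memLp_lowDiff f N s)

theorem expCoeff_highDiff {f : ℝ → ℂ} (hf : Function.Periodic f 1) (hm : Measurable f)
    (h : MemLp f 2 unitMeasure) {N : ℕ} (s : ℝ) (k : ℤ) :
    expCoeff (highDiff f N s) k =
    (1 - vallePoussinWeight N k) * ((unitExp (-(k * s)) - 1) * expCoeff f k) := by
  have i1 := (memLp_translate_of_periodic hf hm h s).integrable one_le_two
  have i2 := h.integrable one_le_two
  have i3 := (memLp_lowDiff f N s).integrable one_le_two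
  unfold highDiff
  rw [expCoeff_sub (f := fun y => f (y + s) - f y) (i1.sub i2) i3, expCoeff_sub i1 i2,
    expCoeff_lowDiff, expCoeff_translate hf]
  ring

theorem enorm_expCoeff_highDiff_le {f : ℝ → ℂ} (hf : Function.Periodic f 1) (hm : Measurable f)
    (h : MemLp f 2 unitMeasure)
    {N : ℕ} (hN : 0 < N) (s : ℝ) (k : ℤ) :
    ‖expCoeff (highDiff f N s) k‖ₑ ≤ if |k| ≤ N then 0 else 2 * ‖expCoeff f k‖ₑ := by
  rw [expCoeff_highDiff hf hm h]
  split_ifs with hk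
  · simp [vallePoussinWeight_eq_one hN hk]
  · rw [enorm_mul, enorm_mul]
    have h1 : ‖(1 - vallePoussinWeight N k : ℂ)‖ₑ ≤ 1 := by
      rw [← ofReal_norm, ← ENNReal.ofReal_one, ← Complex.ofReal_one, ← Complex.ofReal_sub,
        Complex.norm_real]
      refine ENNReal.ofReal_le_ofReal ?_
      rw [Real.norm_eq_abs, abs_le]
      constructor <;>
        linarith [vallePoussinWeight_le_one hN k, vallePoussinWeight_nonneg N k]
    have h2 : ‖unitExp (-(k * s)) - 1‖ₑ ≤ 2 := by
      rw [← ofReal_norm, ← ENNReal.ofReal_ofNat]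
      exact ENNReal.ofReal_le_ofReal (norm_unitExp_sub_one_le_two _)
    calc _ ≤ 1 * (2 * ‖expCoeff f k‖ₑ) := by gcongr
      _ = _ := one_mul _

theorem tsum_enorm_expCoeff_highDiff_rpow_le {f : ℝ → ℂ} (hf : Function.Periodic f 1) (hm : Measurable f)
    (h : MemLp f 2 unitMeasure)
    {N : ℕ} (hN : 0 < N) (s : ℝ) {p : ℝ} (hp1 : 1 ≤ p) {R : ℝ} (hR : R < N + 1) :
    ∑' k, ‖expCoeff (highDiff f N s) k‖ₑ ^ p ≤
      2 ^ p * ∑' k : {k : ℤ // R < |(k : ℝ)|}, ‖expCoeff f k‖ₑ ^ p := by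
  rw [← ENNReal.tsum_mul_left]
  refine le_trans ?_ (tsum_subtype {k : ℤ | R < |(k : ℝ)|}
    fun k => 2 ^ p * ‖expCoeff f k‖ₑ ^ p).ge
  refine ENNReal.tsum_le_tsum fun k => ?_
  have h0 := enorm_expCoeff_highDiff_le hf hm h hN s k
  have hp : 0 < p := by linarith
  by_cases hk : |k| ≤ N
  · rw [if_pos hk] at h0
    rw [le_antisymm h0 zero_le, ENNReal.zero_rpow_of_pos hp]
    exact zero_le
  · rw [if_neg hk] at h0
    rw [Set.indicator_of_mem]
    · rw [← ENNReal.mul_rpow_of_nonneg _ _ hp.le]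
      gcongr
    · change R < |(k : ℝ)|
      -- An integer |k| > N is at least N + 1, hence larger than R; so nothing is lost in replacing
      -- a real R by its integer part.
      have : ((N : ℤ) + 1 : ℤ) ≤ |k| := by omega
      have : (((N : ℤ) + 1 : ℤ) : ℝ) ≤ ((|k| : ℤ) : ℝ) := by exact_mod_cast this
      push_cast at this
      linarith

/-- The low part accounts for at most δ/2 of a jump, at every point y; the high part must supply the
rest. -/
theorem setOf_le_norm_diff_subset {f : ℝ → ℂ} (h : MemLp f 2 unitMeasure) {N : ℕ}
    (hN : 0 < N) {β : ℝ} (hβ : 0 ≤ β) (hb : ∀ᵐ y ∂unitMeasure, ‖f y‖ ≤ β)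
    {s : ℝ} (hs : 0 ≤ s) {δ : ℝ} (hδ : 40 * β * N * s ≤ δ / 2) :
    {y | δ ≤ ‖f (y + s) - f y‖} ⊆ {y | δ / 2 ≤ ‖highDiff f N s y‖} := by
  intro y hy
  change δ ≤ ‖f (y + s) - f y‖ at hy
  change δ / 2 ≤ ‖f (y + s) - f y - lowDiff f N s y‖
  have h1 := norm_lowDiff_le (h.integrable one_le_two) hβ hb hN hs y
  linarith [norm_sub_norm_le (f (y + s) - f y) (lowDiff f N s y)]

/-- The level set bound at η = δ/2, applied to the high part, whose coefficients are at most twice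
those of f. The constant 16/δ is 4/δ times the bound 2^p ≤ 4. -/
theorem unitMeasure_le_norm_diff_le {f : ℝ → ℂ} (hf : Function.Periodic f 1) (hm : Measurable f)
    (h : MemLp f 2 unitMeasure)
    {N : ℕ} (hN : 0 < N) {β : ℝ} (hβ : 0 ≤ β) (hb : ∀ᵐ y ∂unitMeasure, ‖f y‖ ≤ β)
    {s : ℝ} (hs : 0 ≤ s) {δ : ℝ} (hδ0 : 0 < δ) (hδ : 40 * β * N * s ≤ δ / 2) {R : ℝ}
    (hR : R < N + 1) {p : ℝ} (hp1 : 1 < p) (hp2 : p ≤ 2) :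
    unitMeasure {y | δ ≤ ‖f (y + s) - f y‖} ≤ ENNReal.ofReal (4 / δ) *
      (ENNReal.ofReal (16 / δ) *
        ∑' k : {k : ℤ // R < |(k : ℝ)|}, ‖expCoeff f k‖ₑ ^ p) ^ (1 / (p - 1)) := by
  refine (measure_mono (setOf_le_norm_diff_subset h hN hβ hb hs hδ)).trans
    ((unitMeasure_le_norm_le_rpow (memLp_highDiff hf hm h s) (half_pos hδ0) hp1 hp2).trans ?_)
  have h1 : (2 : ℝ) / (δ / 2) = 4 / δ := by field_simp; norm_num
  have hr : 0 ≤ 1 / (p - 1) := (one_div_pos.2 (sub_pos.2 hp1)).le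
  rw [h1]
  refine mul_le_mul_right (ENNReal.rpow_le_rpow ?_ hr) _
  set T := ∑' k : {k : ℤ // R < |(k : ℝ)|}, ‖expCoeff f k‖ₑ ^ p with hT
  calc _ ≤ ENNReal.ofReal (4 / δ) * (2 ^ p * T) := by
        gcongr
        exact tsum_enorm_expCoeff_highDiff_rpow_le hf hm h hN s hp1.le hR
    _ ≤ ENNReal.ofReal (4 / δ) * (ENNReal.ofReal 4 * T) := by
        gcongr
        calc (2 : ℝ≥0∞) ^ p ≤ 2 ^ (2 : ℝ) := ENNReal.rpow_le_rpow_of_exponent_le one_le_two hp2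
          _ = ENNReal.ofReal 4 := by norm_num
    _ = _ := by
        rw [← mul_assoc, ← ENNReal.ofReal_mul (by positivity)]
        congr 2; ring

/-- The endpoint p = 1: doubling the tail bound δ/8 gives δ/4, half of the level δ/2 required of the
high part. -/
theorem unitMeasure_le_norm_diff_eq_zero {f : ℝ → ℂ} (hf : Function.Periodic f 1) (hm : Measurable f)
    (h : MemLp f 2 unitMeasure)
    {N : ℕ} (hN : 0 < N) {β : ℝ} (hβ : 0 ≤ β)
    (hb : ∀ᵐ y ∂unitMeasure, ‖f y‖ ≤ β) {s : ℝ} (hs : 0 ≤ s) {δ : ℝ} (hδ0 : 0 < δ)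
    (hδ : 40 * β * N * s ≤ δ / 2) {R : ℝ} (hR : R < N + 1)
    (hT : ∑' k : {k : ℤ // R < |(k : ℝ)|}, ‖expCoeff f k‖ₑ ≤ ENNReal.ofReal (δ / 8)) :
    unitMeasure {y | δ ≤ ‖f (y + s) - f y‖} = 0 := by
  refine measure_mono_null (setOf_le_norm_diff_subset h hN hβ hb hs hδ)
    (unitMeasure_le_norm_eq_zero (memLp_highDiff hf hm h s) (half_pos hδ0) ?_)
  have := tsum_enorm_expCoeff_highDiff_rpow_le hf hm h hN s le_rfl hR
  simp only [ENNReal.rpow_one] at this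
  refine this.trans ((mul_le_mul_right hT _).trans (le_of_eq ?_))
  rw [← ENNReal.ofReal_ofNat, ← ENNReal.ofReal_mul (by norm_num)]
  congr 1; ring

/-! ### Quasi-periodic functions and the inverse Zak transform -/

/-- The image of `L²(ℝ)` under the Zak transform: measurable functions which are square-integrable
on the unit square and satisfy `G (x + 1) y = e^{2πiy} G x y` and `G x (y + 1) = G x y`. -/
structure IsQuasiPeriodic (G : ℝ → ℝ → ℂ) : Prop where
  measurable : Measurable (Function.uncurry G)
  add_one_left : ∀ x y, G (x + 1) y = unitExp y * G x y
  add_one_right : ∀ x y, G x (y + 1) = G x y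
  memLp : MemLp (Function.uncurry G) 2 (unitMeasure.prod unitMeasure)

/-- The inverse Zak transform. -/
noncomputable def zakInv (G : ℝ → ℝ → ℂ) (x : ℝ) : ℂ := ∫ y, G x y ∂unitMeasure

/-- `conj ∘ ĝ` has Zak transform `zakDual G` if `g` has Zak transform `G`. -/
noncomputable def zakDual (G : ℝ → ℝ → ℂ) (y x : ℝ) : ℂ := unitExp (x * y) * starRingEnd ℂ (G x y)

theorem iUnion_Ioc_int : ⋃ k : ℤ, Set.Ioc (k : ℝ) (k + 1) = Set.univ := iUnion_Ioc_intCast ℝ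

theorem lintegral_eq_tsum_unit (f : ℝ → ℝ≥0∞) :
    ∫⁻ x, f x = ∑' k : ℤ, ∫⁻ x, f (x + k) ∂unitMeasure := by
  rw [← setLIntegral_univ, ← iUnion_Ioc_int,
    lintegral_iUnion (fun _ => measurableSet_Ioc) (Set.pairwise_disjoint_Ioc_intCast ℝ)]
  refine tsum_congr fun k => ?_
  rw [(measurePreserving_add_right volume (k : ℝ)).setLIntegral_comp_emb
      (measurableEmbedding_addRight _) f (Set.Ioc 0 1)]
  simp [add_comm]

theorem hasSum_integral_unit {f : ℝ → ℂ} (hf : Integrable f) :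
    HasSum (fun k : ℤ => ∫ x, f (x + k) ∂unitMeasure) (∫ x, f x) := by
  have := hasSum_integral_iUnion (μ := volume) (f := f) (fun k : ℤ => measurableSet_Ioc)
    (Set.pairwise_disjoint_Ioc_intCast ℝ) hf.integrableOn
  rw [iUnion_Ioc_int, setIntegral_univ] at this
  have h : ∀ k : ℤ, ∫ x, f (x + k) ∂unitMeasure = ∫ x in Set.Ioc (k : ℝ) (k + 1), f x := by
    intro k
    rw [← (measurePreserving_add_right volume (k : ℝ)).setIntegral_preimage_emb
      (measurableEmbedding_addRight _) f (Set.Ioc (k : ℝ) (k + 1))]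
    simp
  simpa only [h] using this

theorem ae_unit_forall_add_of_ae {P : ℝ → Prop} (h : ∀ᵐ x, P x) :
    ∀ᵐ x ∂unitMeasure, ∀ k : ℤ, P (x + k) := by
  rw [ae_all_iff]
  intro k
  exact ae_restrict_of_ae ((measurePreserving_add_right volume (k : ℝ)).quasiMeasurePreserving.ae h)

namespace IsQuasiPeriodic

variable {G G' : ℝ → ℝ → ℂ}

theorem measurable_right (hG : IsQuasiPeriodic G) (x : ℝ) : Measurable (G x) :=
  hG.measurable.comp measurable_prodMk_left

theorem periodic_right (hG : IsQuasiPeriodic G) (x : ℝ) : Function.Periodic (G x) 1 :=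
  hG.add_one_right x

theorem add_intCast_left (hG : IsQuasiPeriodic G) (x y : ℝ) (k : ℤ) :
    G (x + k) y = unitExp (k * y) * G x y := by
  induction k using Int.induction_on with
  | zero => simp
  | succ n ih =>
    have h1 : x + ((n + 1 : ℤ) : ℝ) = (x + (n : ℤ)) + 1 := by push_cast; ring
    rw [h1, hG.add_one_left, ih, ← mul_assoc, ← unitExp_add]
    congr 2; push_cast; ring
  | pred n ih =>
    have h := hG.add_one_left (x + ((-n - 1 : ℤ) : ℝ)) y
    have h1 : x + ((-n - 1 : ℤ) : ℝ) + 1 = x + ((-n : ℤ) : ℝ) := by push_cast; ring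
    rw [h1, ih] at h
    have h2 : unitExp ((-n : ℤ) * y) = unitExp y * unitExp ((-n - 1 : ℤ) * y) := by
      rw [← unitExp_add]; congr 1; push_cast; ring
    rw [h2, mul_assoc] at h
    exact (mul_left_cancel₀ (unitExp_ne_zero y) h).symm

/-- Quasi-periodicity absorbs the character e^{2πiky} into a shift of x by k. This is the link
between jumps of G in y and tails of g. -/
theorem expCoeff_eq (hG : IsQuasiPeriodic G) (x : ℝ) (k : ℤ) :
    expCoeff (G x) k = zakInv G (x + k) := by
  simp only [expCoeff, zakInv, hG.add_intCast_left]

theorem measurable_zakInv (hG : IsQuasiPeriodic G) : Measurable (zakInv G) :=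
  (hG.measurable.stronglyMeasurable.integral_prod_right' (ν := unitMeasure)).measurable

theorem ae_memLp (hG : IsQuasiPeriodic G) : ∀ᵐ x ∂unitMeasure, MemLp (G x) 2 unitMeasure := by
  have h := (hG.memLp.integrable_norm_pow two_ne_zero).prod_right_ae
  filter_upwards [h] with x hx
  rw [memLp_two_iff_integrable_sq_norm (hG.measurable_right x).aestronglyMeasurable]
  exact hx

/-- Parseval in y on almost every slice, followed by reassembling ℝ from the translates of the unit
interval. -/
theorem lintegral_enorm_sq_zakInv (hG : IsQuasiPeriodic G) :
    ∫⁻ x, ‖zakInv G x‖ₑ ^ 2 =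
      ∫⁻ z, ‖Function.uncurry G z‖ₑ ^ 2 ∂(unitMeasure.prod unitMeasure) := by
  rw [lintegral_eq_tsum_unit, ← lintegral_tsum, lintegral_prod]
  · refine lintegral_congr_ae ?_
    filter_upwards [hG.ae_memLp] with x hx
    simp only [Function.uncurry_apply_pair]
    rw [← tsum_enorm_sq_expCoeff hx]
    simp only [hG.expCoeff_eq]
  · exact (hG.measurable.enorm.pow_const 2).aemeasurable
  · intro k
    exact ((hG.measurable_zakInv.comp (measurable_id.add_const _)).enorm.pow_const 2).aemeasurable

theorem eLpNorm_zakInv (hG : IsQuasiPeriodic G) :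
    eLpNorm (zakInv G) 2 volume =
      eLpNorm (Function.uncurry G) 2 (unitMeasure.prod unitMeasure) := by
  rw [eLpNorm_eq_lintegral_rpow_enorm_toReal two_ne_zero ENNReal.ofNat_ne_top,
    eLpNorm_eq_lintegral_rpow_enorm_toReal two_ne_zero ENNReal.ofNat_ne_top]
  simpa using congrArg (· ^ (1 / 2 : ℝ)) hG.lintegral_enorm_sq_zakInv

theorem memLp_zakInv (hG : IsQuasiPeriodic G) : MemLp (zakInv G) 2 volume :=
  ⟨hG.measurable_zakInv.aestronglyMeasurable, hG.eLpNorm_zakInv ▸ hG.memLp.2⟩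

theorem sub (hG : IsQuasiPeriodic G) (hG' : IsQuasiPeriodic G') :
    IsQuasiPeriodic fun x y => G x y - G' x y where
  measurable := hG.measurable.sub hG'.measurable
  add_one_left x y := by rw [hG.add_one_left, hG'.add_one_left, mul_sub]
  add_one_right x y := by rw [hG.add_one_right, hG'.add_one_right]
  memLp := hG.memLp.sub hG'.memLp

theorem ae_integrable (hG : IsQuasiPeriodic G) : ∀ᵐ x, Integrable (G x) unitMeasure := by
  have h1 : ∀ᵐ x ∂unitMeasure, Integrable (G x) unitMeasure :=
    hG.ae_memLp.mono fun x hx => hx.integrable one_le_two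
  refine ae_add_of_ae_of_periodic (fun x => ?_) h1
  have h2 : G (x + 1) = fun y => unitExp (1 * y) * G x y := by
    ext y; rw [hG.add_one_left, one_mul]
  refine ⟨fun h => ?_, fun h => ?_⟩
  · have h3 := integrable_unitExp_mul h (-1)
    refine h3.congr (Filter.Eventually.of_forall fun y => ?_)
    simp only [hG.add_one_left, neg_one_mul]
    rw [← mul_assoc, unitExp_neg_mul_self, one_mul]
  · rw [h2]; exact integrable_unitExp_mul h 1

theorem zakInv_sub (hG : IsQuasiPeriodic G) (hG' : IsQuasiPeriodic G') :
    zakInv (fun x y => G x y - G' x y) =ᵐ[volume] zakInv G - zakInv G' := by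
  filter_upwards [hG.ae_integrable, hG'.ae_integrable] with x h1 h2
  exact integral_sub h1 h2

theorem eLpNorm_zakInv_sub (hG : IsQuasiPeriodic G) (hG' : IsQuasiPeriodic G') :
    eLpNorm (zakInv G - zakInv G') 2 volume =
      eLpNorm (Function.uncurry G - Function.uncurry G') 2 (unitMeasure.prod unitMeasure) := by
  rw [← eLpNorm_congr_ae (hG.zakInv_sub hG'), (hG.sub hG').eLpNorm_zakInv]
  rfl

/-- The twist e^{2πixy} exchanges the two variables: a unit step in y now creates the factor
e^{2πix}, and in a unit step in x the twist cancels the conjugated factor of G. -/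
theorem zakDual (hG : IsQuasiPeriodic G) : IsQuasiPeriodic (zakDual G) where
  measurable := by
    have h1 : Measurable fun z : ℝ × ℝ => G z.2 z.1 := hG.measurable.comp measurable_swap
    exact (measurable_unitExp.comp (by fun_prop : Measurable fun z : ℝ × ℝ => z.2 * z.1)).mul
      (Complex.continuous_conj.measurable.comp h1)
  add_one_left y x := by
    rw [_root_.zakDual, _root_.zakDual, hG.add_one_right, mul_add, mul_one, unitExp_add]
    ring
  add_one_right y x := by
    rw [_root_.zakDual, _root_.zakDual, hG.add_one_left, map_mul, conj_unitExp, add_mul, one_mul,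
      unitExp_add]
    linear_combination unitExp (x * y) * starRingEnd ℂ (G x y) * unitExp_neg_mul_self y
  memLp := by
    have h1 : MemLp (fun z : ℝ × ℝ => G z.2 z.1) 2 (unitMeasure.prod unitMeasure) :=
      hG.memLp.comp_measurePreserving Measure.measurePreserving_swap
    have h2 : Measurable fun z : ℝ × ℝ => G z.2 z.1 := hG.measurable.comp measurable_swap
    refine h1.of_le ?_ (Filter.Eventually.of_forall fun z => ?_)
    · exact ((measurable_unitExp.comp (by fun_prop : Measurable fun z : ℝ × ℝ => z.2 * z.1)).mul
        (Complex.continuous_conj.measurable.comp h2)).aestronglyMeasurable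
    · simp [Function.uncurry, _root_.zakDual]

/-- Convergence of G on the square thus passes simultaneously to the inverse Zak transforms of G and
of its dual, hence to g and ĝ. -/
theorem eLpNorm_zakInv_zakDual_sub (hG : IsQuasiPeriodic G) (hG' : IsQuasiPeriodic G') :
    eLpNorm (zakInv (_root_.zakDual G) - zakInv (_root_.zakDual G')) 2 volume =
      eLpNorm (Function.uncurry G - Function.uncurry G') 2 (unitMeasure.prod unitMeasure) := by
  rw [hG.zakDual.eLpNorm_zakInv_sub hG'.zakDual]
  have h1 : eLpNorm (Function.uncurry G - Function.uncurry G') 2 (unitMeasure.prod unitMeasure) =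
      eLpNorm ((Function.uncurry G - Function.uncurry G') ∘ Prod.swap) 2
        (unitMeasure.prod unitMeasure) :=
    (eLpNorm_comp_measurePreserving (hG.measurable.sub hG'.measurable).aestronglyMeasurable
      Measure.measurePreserving_swap).symm
  rw [h1]
  refine eLpNorm_congr_norm_ae (Filter.Eventually.of_forall fun z => ?_)
  simp only [Function.uncurry, _root_.zakDual, Pi.sub_apply, Function.comp, Prod.swap]
  rw [← mul_sub, norm_mul, norm_unitExp, one_mul, ← map_sub, RCLike.norm_conj]

end IsQuasiPeriodic

theorem zakInv_zakDual (G : ℝ → ℝ → ℂ) (ξ : ℝ) : zakInv (zakDual G) ξ =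
    starRingEnd ℂ (∫ x, unitExp (-(x * ξ)) * G x ξ ∂unitMeasure) := by
  rw [← integral_conj, zakInv]
  simp [zakDual, conj_unitExp]

/-! ### Existence of the Zak transform -/

/-- The quasi-periodic extension of a function on the unit square. -/
noncomputable def quasiPeriodicExt (F : ℝ × ℝ → ℂ) (x y : ℝ) : ℂ :=
  unitExp (⌊x⌋ * y) * F (Int.fract x, Int.fract y)

theorem quasiPeriodicExt_ae_eq (F : ℝ × ℝ → ℂ) :
    Function.uncurry (quasiPeriodicExt F) =ᵐ[unitMeasure.prod unitMeasure] F := by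
  -- `unitMeasure` lives on (0, 1] while fractional parts lie in [0, 1); the endpoints are null.
  have h0 : ∀ᵐ x ∂unitMeasure, x ∈ Set.Ico (0 : ℝ) 1 := by
    rw [unitMeasure, ← restrict_Ico_eq_restrict_Ioc]
    exact ae_restrict_mem measurableSet_Ico
  have h1 : ∀ᵐ z ∂(unitMeasure.prod unitMeasure), z.1 ∈ Set.Ico (0 : ℝ) 1 :=
    Measure.quasiMeasurePreserving_fst.ae h0
  have h2 : ∀ᵐ z ∂(unitMeasure.prod unitMeasure), z.2 ∈ Set.Ico (0 : ℝ) 1 :=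
    Measure.quasiMeasurePreserving_snd.ae h0
  filter_upwards [h1, h2] with z hz1 hz2
  rw [Function.uncurry, quasiPeriodicExt, Int.fract_eq_self.2 hz1, Int.fract_eq_self.2 hz2,
    Int.floor_eq_zero_iff.2 hz1]
  simp

theorem isQuasiPeriodic_quasiPeriodicExt {F : ℝ × ℝ → ℂ} (hF : Measurable F)
    (hL : MemLp F 2 (unitMeasure.prod unitMeasure)) : IsQuasiPeriodic (quasiPeriodicExt F) where
  measurable := by
    have h1 : Measurable fun z : ℝ × ℝ => (⌊z.1⌋ : ℝ) * z.2 :=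
      ((measurable_from_top (f := fun n : ℤ => (n : ℝ))).comp
        (Int.measurable_floor.comp measurable_fst)).mul measurable_snd
    exact (measurable_unitExp.comp h1).mul (hF.comp
      ((measurable_fract.comp measurable_fst).prodMk (measurable_fract.comp measurable_snd)))
  add_one_left x y := by
    simp only [quasiPeriodicExt, Int.floor_add_one, Int.fract_add_one]
    push_cast
    rw [add_mul, one_mul, unitExp_add]
    ring
  add_one_right x y := by
    simp only [quasiPeriodicExt, Int.fract_add_one]
    rw [mul_add, mul_one, unitExp_add_intCast]
  memLp := hL.ae_eq (quasiPeriodicExt_ae_eq F).symm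

theorem ae_eq_of_forall_integral_schwartz {f g : ℝ → ℂ} (hf : LocallyIntegrable f)
    (hg : LocallyIntegrable g)
    (h : ∀ φ : SchwartzMap ℝ ℂ, ∫ x, φ x • f x = ∫ x, φ x • g x) : f =ᵐ[volume] g := by
  refine ae_eq_of_integral_contDiff_smul_eq hf hg fun φ hφ hc => ?_
  have hs : HasCompactSupport fun x => (φ x : ℂ) := hc.comp_left Complex.ofReal_zero
  have hd : ContDiff ℝ (⊤ : ℕ∞) fun x => (φ x : ℂ) := Complex.ofRealCLM.contDiff.comp hφ
  have := h (hs.toSchwartzMap hd)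
  simpa using this

/-- On `L¹ ∩ L²` the Fourier transform of `L²` is given by the Fourier integral. -/
theorem fourier_toLp_ae_eq {c : ℝ → ℂ} (h1 : Integrable c) (h2 : MemLp c 2 volume) :
    (𝓕 (h2.toLp c) : Lp ℂ 2 (volume : Measure ℝ)) =ᵐ[volume] 𝓕 c := by
  have hcont : Continuous (𝓕 c) := by
    exact VectorFourier.fourierIntegral_continuous Real.continuous_fourierChar
      (by fun_prop) h1
  refine ae_eq_of_forall_integral_schwartz
    ((Lp.memLp _).locallyIntegrable one_le_two) hcont.locallyIntegrable fun φ => ?_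
  have hT := congrArg (fun T : TemperedDistribution ℝ ℂ => T φ)
    (Lp.fourier_toTemperedDistribution_eq (h2.toLp c))
  simp only [Lp.toTemperedDistribution_apply, TemperedDistribution.fourier_apply] at hT
  rw [← hT]
  have h3 : ∫ x, (𝓕 φ) x • (h2.toLp c) x = ∫ x, (𝓕 φ) x • c x := by
    refine integral_congr_ae ?_
    filter_upwards [h2.coeFn_toLp] with x hx
    rw [hx]
  rw [h3]
  simp only [smul_eq_mul, SchwartzMap.fourier_coe]
  simpa using! VectorFourier.integral_fourierIntegral_smul_eq_flip (L := innerₗ ℝ)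
    Real.continuous_fourierChar continuous_inner (φ.integrable (μ := volume)) h1

/-- The Zak transform of a function that vanishes outside the intervals `(k, k + 1]`, `k ∈ s`. -/
noncomputable def zakFinite (s : Finset ℤ) (c : ℝ → ℂ) (x y : ℝ) : ℂ :=
  ∑ k ∈ s, unitExp (-((k + 1 - ⌈x⌉ : ℤ) : ℝ) * y) * c (x + (k + 1 - ⌈x⌉ : ℤ))

/-- The point x + (k + 1 - ⌈x⌉) is the representative of x modulo ℤ in (k, k + 1], so it does not
change under x ↦ x + 1. Quasi-periodicity therefore holds everywhere, not just almost everywhere. -/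
theorem isQuasiPeriodic_zakFinite (s : Finset ℤ) {c : ℝ → ℂ} (hm : Measurable c)
    (hc : MemLp c 2 volume) : IsQuasiPeriodic (zakFinite s c) where
  measurable := by
    unfold zakFinite
    refine Finset.measurable_sum (f := fun (k : ℤ) (z : ℝ × ℝ) =>
      unitExp (-((k + 1 - ⌈z.1⌉ : ℤ) : ℝ) * z.2) * c (z.1 + (k + 1 - ⌈z.1⌉ : ℤ))) s fun k _ => ?_
    have h1 : Measurable fun z : ℝ × ℝ => ((k + 1 - ⌈z.1⌉ : ℤ) : ℝ) :=
      (measurable_from_top (f := fun n : ℤ => ((k + 1 - n : ℤ) : ℝ))).comp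
        (Int.measurable_ceil.comp measurable_fst)
    exact (measurable_unitExp.comp (h1.neg.mul measurable_snd)).mul
      (hm.comp (measurable_fst.add h1))
  add_one_left x y := by
    rw [zakFinite, zakFinite, Finset.mul_sum]
    refine Finset.sum_congr rfl fun k _ => ?_
    rw [Int.ceil_add_one, ← mul_assoc, ← unitExp_add]
    congr 2
    · push_cast; ring
    · push_cast; ring
  add_one_right x y := by
    rw [zakFinite, zakFinite]
    refine Finset.sum_congr rfl fun k _ => ?_
    rw [mul_add, mul_one, ← Int.cast_neg, unitExp_add_intCast]
  memLp := by
    have h1 : ∀ k : ℤ, MemLp (fun z : ℝ × ℝ => c (z.1 + k)) 2 (unitMeasure.prod unitMeasure) := by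
      intro k
      have h2 : MemLp (fun x => c (x + k)) 2 unitMeasure :=
        (hc.comp_measurePreserving (measurePreserving_add_right volume (k : ℝ))).restrict _
      exact h2.comp_fst unitMeasure
    have h2 : MemLp (fun z : ℝ × ℝ => ∑ k ∈ s, unitExp (-(k : ℝ) * z.2) * c (z.1 + k)) 2
        (unitMeasure.prod unitMeasure) := by
      refine memLp_finsetSum s fun k _ => (h1 k).of_le ?_ (Filter.Eventually.of_forall fun z => ?_)
      · exact (Continuous.aestronglyMeasurable (by fun_prop)).mul (h1 k).aestronglyMeasurable
      · simp
    refine h2.ae_eq ?_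
    have h0 : ∀ᵐ z ∂(unitMeasure.prod unitMeasure), z.1 ∈ Set.Ioc (0 : ℝ) 1 :=
      Measure.quasiMeasurePreserving_fst.ae (ae_restrict_mem measurableSet_Ioc)
    filter_upwards [h0] with z hz
    have : ⌈z.1⌉ = 1 := Int.ceil_eq_iff.2 ⟨by simpa using hz.1, by simpa using hz.2⟩
    simp [Function.uncurry, zakFinite, this]

/-- Integration in y keeps the term with shift 0, that is, the cell (k, k + 1] containing x. -/
theorem zakInv_zakFinite (s : Finset ℤ) (c : ℝ → ℂ) (x : ℝ) :
    zakInv (zakFinite s c) x = if ⌈x⌉ - 1 ∈ s then c x else 0 := by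
  have h := expCoeff_expSum s (fun k => c (x + (k + 1 - ⌈x⌉ : ℤ))) (fun k => k + 1 - ⌈x⌉) 0
  have h2 : zakInv (zakFinite s c) x = expCoeff (fun y => ∑ i ∈ s,
      c (x + (i + 1 - ⌈x⌉ : ℤ)) * unitExp (-((i + 1 - ⌈x⌉ : ℤ) : ℝ) * y)) 0 := by
    simp only [zakInv, expCoeff, zakFinite, mul_comm (unitExp (-_ * _)), Int.cast_zero, zero_mul, unitExp_zero,
      one_mul]
  rw [h2, h]
  have h3 : ∀ k, (k + 1 - ⌈x⌉ = 0) ↔ k = ⌈x⌉ - 1 := fun k => by omega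
  simp only [h3]
  rw [Finset.sum_ite_eq']
  simp

/-- The Fourier integral is cut into unit cells: on the cell k its character at x + k is e^{-2πixξ}
e^{-2πikξ}, the second factor being the one in the Zak sum. -/
theorem integral_zakFinite {s : Finset ℤ} {c : ℝ → ℂ} (hc : Integrable c)
    (hs : ∀ x, ⌈x⌉ - 1 ∉ s → c x = 0) (ξ : ℝ) :
    ∫ x, unitExp (-(x * ξ)) * zakFinite s c x ξ ∂unitMeasure = 𝓕 c ξ := by
  have hF : 𝓕 c ξ = ∫ x, unitExp (-(x * ξ)) * c x := by
    rw [Real.fourier_eq']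
    refine integral_congr_ae (Filter.Eventually.of_forall fun x => ?_)
    simp only [unitExp, smul_eq_mul]
    congr 2
    simp only [RCLike.inner_apply, conj_trivial]
    push_cast
    ring
  have hint : Integrable fun x => unitExp (-(x * ξ)) * c x :=
    hc.bdd_mul (c := 1) (Continuous.aestronglyMeasurable (by fun_prop))
      (Filter.Eventually.of_forall fun x => by simp)
  have hsum := hasSum_integral_unit hint
  have h1 : ∀ᵐ x ∂unitMeasure, ⌈x⌉ = 1 := by
    filter_upwards [ae_restrict_mem (measurableSet_Ioc : MeasurableSet (Set.Ioc (0 : ℝ) 1))] with x hx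
    exact Int.ceil_eq_iff.2 ⟨by simpa using hx.1, by simpa using hx.2⟩
  rw [hF, ← hsum.tsum_eq, tsum_eq_sum (s := s), ← integral_finsetSum]
  · refine integral_congr_ae ?_
    filter_upwards [h1] with x hx
    rw [zakFinite, hx, Finset.mul_sum]
    refine Finset.sum_congr rfl fun k _ => ?_
    rw [← mul_assoc, ← unitExp_add]
    congr 2
    · push_cast; ring
    · push_cast; ring
  · intro k _
    exact (hint.comp_add_right (k : ℝ)).restrict
  · intro k hk
    refine integral_eq_zero_of_ae ?_
    filter_upwards [h1] with x hx
    rw [hs, mul_zero]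
    · rfl
    · rwa [Int.ceil_add_intCast, hx, add_comm, add_sub_cancel_right]

theorem ae_eq_of_tendsto_eLpNorm {α : Type*} [MeasurableSpace α] {μ : Measure α}
    {f : ℕ → α → ℂ} {a b : α → ℂ} (hf : ∀ n, AEStronglyMeasurable (f n) μ)
    (ha : AEStronglyMeasurable a μ) (hb : AEStronglyMeasurable b μ)
    (h1 : Filter.Tendsto (fun n => eLpNorm (f n - a) 2 μ) Filter.atTop (nhds 0))
    (h2 : Filter.Tendsto (fun n => eLpNorm (f n - b) 2 μ) Filter.atTop (nhds 0)) :
    a =ᵐ[μ] b := by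
  have h3 : eLpNorm (a - b) 2 μ = 0 := by
    have h4 := h1.add h2
    rw [add_zero] at h4
    refine le_antisymm (ge_of_tendsto' h4 fun n => ?_) zero_le
    have h5 : a - b = (f n - b) - (f n - a) := by abel
    rw [h5, add_comm]
    exact eLpNorm_sub_le ((hf n).sub hb) ((hf n).sub ha) one_le_two
  have := (eLpNorm_eq_zero_iff (ha.sub hb) two_ne_zero).1 h3
  filter_upwards [this] with x hx
  exact sub_eq_zero.1 hx

theorem exists_finset_ceil_of_hasCompactSupport {c : ℝ → ℂ} (hc : HasCompactSupport c) :
    ∃ s : Finset ℤ, ∀ x, ⌈x⌉ - 1 ∉ s → c x = 0 := by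
  obtain ⟨r, hr⟩ := hc.isCompact.isBounded.subset_closedBall 0
  refine ⟨Finset.Icc (-⌈r⌉ - 1) (⌈r⌉ + 1), fun x hx => ?_⟩
  by_contra h
  have h1 := hr (subset_tsupport c h)
  rw [Metric.mem_closedBall, dist_zero_right, Real.norm_eq_abs, abs_le] at h1
  apply hx
  rw [Finset.mem_Icc]
  have h2 : ⌈x⌉ ≤ ⌈r⌉ := Int.ceil_le_ceil h1.2
  have h3 : -⌈r⌉ ≤ ⌈x⌉ := by
    have := Int.le_ceil r
    have h4 : ((-⌈r⌉ : ℤ) : ℝ) ≤ (⌈x⌉ : ℝ) := by push_cast; linarith [Int.le_ceil x, h1.1]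
    exact_mod_cast h4
  omega

theorem exists_quasiPeriodic_of_hasCompactSupport {c : ℝ → ℂ} (hcont : Continuous c)
    (hc : HasCompactSupport c) (hL : MemLp c 2 volume) : ∃ G, IsQuasiPeriodic G ∧ zakInv G = c ∧
      zakInv (zakDual G) = fun ξ => starRingEnd ℂ (𝓕 c ξ) := by
  obtain ⟨s, hs⟩ := exists_finset_ceil_of_hasCompactSupport hc
  refine ⟨zakFinite s c, isQuasiPeriodic_zakFinite s hcont.measurable hL, ?_, ?_⟩
  · ext x
    rw [zakInv_zakFinite]
    split_ifs with h
    · rfl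
    · exact (hs x h).symm
  · ext ξ
    rw [zakInv_zakDual, integral_zakFinite (hcont.integrable_of_hasCompactSupport hc) hs]

/-- Continuous compactly supported functions approximate g and have explicit Zak transforms. These
are Cauchy by isometry, and their limit on the square extends quasi-periodically. Both inverse
transforms are continuous in L², as is the Fourier transform, so both identities survive the limit.
-/
theorem exists_zak (g : Lp ℂ 2 (volume : Measure ℝ)) : ∃ G, IsQuasiPeriodic G ∧
    zakInv G =ᵐ[volume] g ∧ zakInv (zakDual G) =ᵐ[volume]
      fun ξ => starRingEnd ℂ ((𝓕 g : Lp ℂ 2 (volume : Measure ℝ)) ξ) := by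
  have happ : ∀ n : ℕ, ∃ c : ℝ → ℂ, HasCompactSupport c ∧
      eLpNorm ((g : ℝ → ℂ) - c) 2 volume ≤ ((n : ℝ≥0∞) + 1)⁻¹ ∧ Continuous c ∧ MemLp c 2 volume :=
    fun n => (Lp.memLp g).exists_hasCompactSupport_eLpNorm_sub_le ENNReal.ofNat_ne_top
      (by simp)
  choose c hcs hcg hcc hcL using happ
  have hlim0 : Filter.Tendsto (fun n : ℕ => ((n : ℝ≥0∞) + 1)⁻¹) Filter.atTop (nhds 0) := by
    have := (Filter.tendsto_add_atTop_iff_nat 1).2 ENNReal.tendsto_inv_nat_nhds_zero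
    simpa using this
  have hcg0 : Filter.Tendsto (fun n => eLpNorm (c n - (g : ℝ → ℂ)) 2 volume) Filter.atTop (nhds 0) :=
    tendsto_of_tendsto_of_tendsto_of_le_of_le tendsto_const_nhds hlim0 (fun _ => zero_le)
      fun n => by rw [eLpNorm_sub_comm]; exact hcg n
  choose G hG hGc hGF using fun n =>
    exists_quasiPeriodic_of_hasCompactSupport (hcc n) (hcs n) (hcL n)
  have hcl : Filter.Tendsto (fun n => (hcL n).toLp (c n)) Filter.atTop (nhds g) := by
    rw [Lp.tendsto_Lp_iff_tendsto_eLpNorm']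
    refine hcg0.congr fun n => eLpNorm_congr_ae ?_
    filter_upwards [(hcL n).coeFn_toLp] with x hx
    simp [hx]
  have hcauchy : CauchySeq fun n => (hG n).memLp.toLp (Function.uncurry (G n)) := by
    have h1 := hcl.cauchySeq
    rw [EMetric.cauchySeq_iff] at h1 ⊢
    intro ε hε
    obtain ⟨N, hN⟩ := h1 ε hε
    refine ⟨N, fun m hm n hn => ?_⟩
    have := hN m hm n hn
    rw [Lp.edist_toLp_toLp] at this ⊢
    rwa [← (hG m).eLpNorm_zakInv_sub (hG n), hGc, hGc]
  obtain ⟨u, hu⟩ := cauchySeq_tendsto_of_complete hcauchy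
  have hum : Measurable (u : ℝ × ℝ → ℂ) := (Lp.stronglyMeasurable u).measurable
  have hQ := isQuasiPeriodic_quasiPeriodicExt hum (Lp.memLp u)
  have hlim : Filter.Tendsto (fun n => eLpNorm (Function.uncurry (G n) -
      Function.uncurry (quasiPeriodicExt u)) 2 (unitMeasure.prod unitMeasure))
      Filter.atTop (nhds 0) := by
    rw [Lp.tendsto_Lp_iff_tendsto_eLpNorm'] at hu
    refine hu.congr fun n => eLpNorm_congr_ae ?_
    filter_upwards [(hG n).memLp.coeFn_toLp, quasiPeriodicExt_ae_eq u] with x hx hx2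
    simp [hx, hx2]
  refine ⟨quasiPeriodicExt u, hQ, ?_, ?_⟩
  · refine ae_eq_of_tendsto_eLpNorm (f := c) (fun n => (hcL n).aestronglyMeasurable)
      hQ.memLp_zakInv.aestronglyMeasurable (Lp.aestronglyMeasurable g) ?_ hcg0
    refine hlim.congr fun n => ?_
    rw [← (hG n).eLpNorm_zakInv_sub hQ, hGc]
  · have hconj : ∀ {f : ℝ → ℂ}, AEStronglyMeasurable f volume →
        AEStronglyMeasurable (fun x => starRingEnd ℂ (f x)) volume := fun hf =>
      Complex.continuous_conj.comp_aestronglyMeasurable hf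
    refine ae_eq_of_tendsto_eLpNorm (f := fun n => zakInv (zakDual (G n)))
      (fun n => (hG n).zakDual.memLp_zakInv.aestronglyMeasurable)
      hQ.zakDual.memLp_zakInv.aestronglyMeasurable (hconj (Lp.aestronglyMeasurable _)) ?_ ?_
    · refine hlim.congr fun n => ?_
      rw [(hG n).eLpNorm_zakInv_zakDual_sub hQ]
    · have h1 : Filter.Tendsto (fun n => (𝓕 ((hcL n).toLp (c n)) : Lp ℂ 2 (volume : Measure ℝ)))
          Filter.atTop (nhds (𝓕 g)) :=
        ((Lp.fourierTransformₗᵢ ℝ ℂ).continuous.tendsto g).comp hcl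
      rw [Lp.tendsto_Lp_iff_tendsto_eLpNorm'] at h1
      refine h1.congr fun n => eLpNorm_congr_norm_ae ?_
      filter_upwards [fourier_toLp_ae_eq ((hcc n).integrable_of_hasCompactSupport (hcs n)) (hcL n)]
        with x hx
      simp only [Pi.sub_apply, hGF, hx]
      rw [← map_sub, RCLike.norm_conj]

/-! ### Characters of the unit square -/

/-- Lebesgue measure on the unit square. -/
noncomputable abbrev squareMeasure : Measure (ℝ × ℝ) := unitMeasure.prod unitMeasure

/-- The character `(x, y) ↦ e^{2πi(nx - my)}`. -/
noncomputable def planeExp (i : ℤ × ℤ) (z : ℝ × ℝ) : ℂ := unitExp (i.2 * z.1) * unitExp (-i.1 * z.2)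

@[fun_prop] theorem continuous_planeExp (i : ℤ × ℤ) : Continuous (planeExp i) := by
  unfold planeExp; fun_prop

@[simp] theorem norm_planeExp (i : ℤ × ℤ) (z : ℝ × ℝ) : ‖planeExp i z‖ = 1 := by simp [planeExp]

theorem memLp_planeExp (i : ℤ × ℤ) : MemLp (planeExp i) 2 squareMeasure :=
  MemLp.of_bound (continuous_planeExp i).aestronglyMeasurable 1
    (Filter.Eventually.of_forall fun z => by simp)

/-- The characters of the unit square as elements of `L²`. -/
noncomputable def planeExpLp (i : ℤ × ℤ) : Lp ℂ 2 squareMeasure := (memLp_planeExp i).toLp _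

theorem conj_planeExp (i : ℤ × ℤ) (z : ℝ × ℝ) :
    starRingEnd ℂ (planeExp i z) = unitExp ((-i.2 : ℤ) * z.1) * unitExp (i.1 * z.2) := by
  rw [planeExp, map_mul, conj_unitExp, conj_unitExp]
  congr 2 <;> push_cast <;> ring

theorem inner_planeExpLp (i : ℤ × ℤ) (f : Lp ℂ 2 squareMeasure) :
    inner ℂ (planeExpLp i) f =
      ∫ z, unitExp ((-i.2 : ℤ) * z.1) * unitExp (i.1 * z.2) * f z ∂squareMeasure := by
  rw [L2.inner_def]
  refine integral_congr_ae ?_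
  filter_upwards [(memLp_planeExp i).coeFn_toLp] with z hz
  rw [planeExpLp, hz, RCLike.inner_apply, conj_planeExp, mul_comm]

theorem orthonormal_planeExpLp : Orthonormal ℂ planeExpLp := by
  classical
  rw [orthonormal_iff_ite]
  intro i j
  rw [inner_planeExpLp]
  have h : ∫ z, unitExp ((-i.2 : ℤ) * z.1) * unitExp (i.1 * z.2) * planeExpLp j z ∂squareMeasure =
      ∫ z, unitExp ((j.2 - i.2 : ℤ) * z.1) * unitExp ((i.1 - j.1 : ℤ) * z.2) ∂squareMeasure := by
    refine integral_congr_ae ?_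
    filter_upwards [(memLp_planeExp j).coeFn_toLp] with z hz
    rw [planeExpLp, hz, planeExp]
    have h1 : ((j.2 - i.2 : ℤ) : ℝ) * z.1 = (-i.2 : ℤ) * z.1 + j.2 * z.1 := by push_cast; ring
    have h2 : ((i.1 - j.1 : ℤ) : ℝ) * z.2 = i.1 * z.2 + -j.1 * z.2 := by push_cast; ring
    rw [h1, h2, unitExp_add, unitExp_add]
    ring
  rw [h, integral_prod_mul (fun x : ℝ => unitExp ((j.2 - i.2 : ℤ) * x))
    (fun y : ℝ => unitExp ((i.1 - j.1 : ℤ) * y)), integral_unitExp_intCast_mul,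
    integral_unitExp_intCast_mul]
  by_cases h1 : i.1 = j.1 <;> by_cases h2 : i.2 = j.2 <;>
    simp [h1, h2, Prod.ext_iff, sub_eq_zero, eq_comm]

/-- Parseval applied in y on the slices, then in x to each coefficient function. -/
theorem lintegral_square_eq_tsum {f : ℝ × ℝ → ℂ} (hm : Measurable f)
    (hf : MemLp f 2 squareMeasure) :
    ∫⁻ z, ‖f z‖ₑ ^ 2 ∂squareMeasure =
      ∑' (m : ℤ) (n : ℤ), ‖expCoeff (fun x => expCoeff (fun y => f (x, y)) m) n‖ₑ ^ 2 := by
  have hfib : ∀ᵐ x ∂unitMeasure, MemLp (fun y => f (x, y)) 2 unitMeasure := by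
    filter_upwards [(hf.integrable_norm_pow two_ne_zero).prod_right_ae] with x hx
    have hmx : Measurable fun y => f (x, y) := hm.comp measurable_prodMk_left
    exact (memLp_two_iff_integrable_sq_norm hmx.aestronglyMeasurable).2 hx
  have hmc : ∀ m : ℤ, Measurable fun x => expCoeff (fun y => f (x, y)) m := by
    intro m
    have : Measurable fun z : ℝ × ℝ => unitExp (m * z.2) * f z :=
      (Continuous.measurable (by fun_prop)).mul hm
    exact (this.stronglyMeasurable.integral_prod_right' (ν := unitMeasure)).measurable
  have h1 : ∫⁻ z, ‖f z‖ₑ ^ 2 ∂squareMeasure =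
      ∑' m : ℤ, ∫⁻ x, ‖expCoeff (fun y => f (x, y)) m‖ₑ ^ 2 ∂unitMeasure := by
    rw [← lintegral_tsum fun m => ((hmc m).enorm.pow_const 2).aemeasurable,
      lintegral_prod _ (hm.enorm.pow_const 2).aemeasurable]
    refine lintegral_congr_ae ?_
    filter_upwards [hfib] with x hx
    rw [tsum_enorm_sq_expCoeff hx]
  rw [h1]
  refine tsum_congr fun m => ?_
  rw [tsum_enorm_sq_expCoeff]
  refine ⟨(hmc m).aestronglyMeasurable, ?_⟩
  rw [eLpNorm_lt_top_iff_lintegral_rpow_enorm_lt_top two_ne_zero ENNReal.ofNat_ne_top]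
  have h2 : ∫⁻ z, ‖f z‖ₑ ^ 2 ∂squareMeasure < ∞ := by
    rw [lintegral_enorm_sq_eq_ofReal hf]; exact ENNReal.ofReal_lt_top
  rw [h1] at h2
  simpa using (ENNReal.le_tsum m).trans_lt h2

theorem span_planeExpLp_closure :
    (Submodule.span ℂ (Set.range planeExpLp)).topologicalClosure = ⊤ := by
  rw [Submodule.topologicalClosure_eq_top_iff, Submodule.eq_bot_iff]
  intro f hf
  have h0 : ∀ i, inner ℂ (planeExpLp i) f = 0 := fun i =>
    hf _ (Submodule.subset_span ⟨i, rfl⟩)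
  have hm : Measurable (f : ℝ × ℝ → ℂ) := (Lp.stronglyMeasurable f).measurable
  have h1 := lintegral_square_eq_tsum hm (Lp.memLp f)
  have hcoef : ∀ m n : ℤ, expCoeff (fun x => expCoeff (fun y => f (x, y)) m) n = 0 := by
    intro m n
    -- The inner product conjugates e^{2πi(nx - my)}, which flips the sign of n relative to
    -- `expCoeff`.
    have h2 := h0 (m, -n)
    rw [inner_planeExpLp, integral_prod] at h2
    · rw [← h2, expCoeff]
      refine integral_congr_ae (Filter.Eventually.of_forall fun x => ?_)
      simp only [neg_neg, mul_assoc, expCoeff]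
      exact (integral_const_mul _ _).symm
    · refine ((Lp.memLp f).integrable one_le_two).bdd_mul (c := 1)
        (Continuous.aestronglyMeasurable (by fun_prop))
        (Filter.Eventually.of_forall fun z => by simp)
  simp only [hcoef, enorm_zero, ne_eq, OfNat.ofNat_ne_zero, not_false_eq_true, zero_pow,
    tsum_zero] at h1
  rw [lintegral_eq_zero_iff (hm.enorm.pow_const 2)] at h1
  rw [Lp.eq_zero_iff_ae_eq_zero]
  filter_upwards [h1] with z hz
  simpa using hz

/-- The trigonometric polynomial with coefficients `a`. -/
noncomputable def trigPoly (a : ℤ × ℤ →₀ ℂ) (z : ℝ × ℝ) : ℂ := a.sum fun i c => c * planeExp i z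

theorem continuous_trigPoly (a : ℤ × ℤ →₀ ℂ) : Continuous (trigPoly a) := by
  unfold trigPoly Finsupp.sum; fun_prop

theorem norm_trigPoly_le (a : ℤ × ℤ →₀ ℂ) (z : ℝ × ℝ) : ‖trigPoly a z‖ ≤ ∑ i ∈ a.support, ‖a i‖ :=
  (norm_sum_le _ _).trans (by simp)

theorem coeFn_sum_planeExpLp (a : ℤ × ℤ →₀ ℂ) :
    (a.sum fun i c => c • planeExpLp i : Lp ℂ 2 squareMeasure) =ᵐ[squareMeasure] trigPoly a := by
  have h1 := Lp.coeFn_finsetSum a.support fun i => a i • planeExpLp i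
  have h2 : ∀ᵐ z ∂squareMeasure, ∀ i, (a i • planeExpLp i : Lp ℂ 2 squareMeasure) z =
      a i * planeExp i z := by
    rw [ae_all_iff]
    intro i
    filter_upwards [Lp.coeFn_smul (a i) (planeExpLp i), (memLp_planeExp i).coeFn_toLp] with z h3 h4
    rw [h3, Pi.smul_apply, planeExpLp, h4, smul_eq_mul]
  filter_upwards [h1, h2] with z h3 h4
  rw [Finsupp.sum, h3, trigPoly, Finsupp.sum, Finset.sum_apply]
  exact Finset.sum_congr rfl fun i _ => h4 i

/-! ### From the Riesz bounds to pointwise bounds on the Zak transform -/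

namespace IsQuasiPeriodic

variable {G : ℝ → ℝ → ℂ}

theorem trigPoly_mul (hG : IsQuasiPeriodic G) (a : ℤ × ℤ →₀ ℂ) :
    IsQuasiPeriodic fun x y => trigPoly a (x, y) * G x y where
  measurable := (continuous_trigPoly a).measurable.mul hG.measurable
  add_one_left x y := by
    have : trigPoly a (x + 1, y) = trigPoly a (x, y) := by
      simp only [trigPoly, planeExp, mul_add, mul_one, unitExp_add_intCast]
    rw [this, hG.add_one_left]; ring
  add_one_right x y := by
    have : trigPoly a (x, y + 1) = trigPoly a (x, y) := by
      simp only [trigPoly, planeExp, mul_add, mul_one, ← Int.cast_neg, unitExp_add_intCast]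
    rw [this, hG.add_one_right]
  memLp := by
    refine hG.memLp.of_le_mul (c := ∑ i ∈ a.support, ‖a i‖)
      ((continuous_trigPoly a).measurable.mul hG.measurable).aestronglyMeasurable
      (Filter.Eventually.of_forall fun z => ?_)
    change ‖trigPoly a z * Function.uncurry G z‖ ≤ _
    rw [norm_mul]
    gcongr
    exact norm_trigPoly_le a z

theorem zakInv_trigPoly_mul (hG : IsQuasiPeriodic G) (a : ℤ × ℤ →₀ ℂ) :
    zakInv (fun x y => trigPoly a (x, y) * G x y) =ᵐ[volume]
      fun x => a.sum fun i c => c * (unitExp (i.2 * x) * zakInv G (x - i.1)) := by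
  filter_upwards [hG.ae_integrable] with x hx
  have h1 : ∀ y, trigPoly a (x, y) * G x y = ∑ i ∈ a.support,
      (a i * unitExp (i.2 * x)) * (unitExp ((-i.1 : ℤ) * y) * G x y) := by
    intro y
    rw [trigPoly, Finsupp.sum, Finset.sum_mul]
    refine Finset.sum_congr rfl fun i _ => ?_
    rw [planeExp]; push_cast; ring
  rw [zakInv]
  simp_rw [h1]
  rw [integral_finsetSum _ fun i _ => (integrable_unitExp_mul hx _).const_mul _, Finsupp.sum]
  refine Finset.sum_congr rfl fun i _ => ?_
  have h2 := hG.expCoeff_eq x (-i.1)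
  rw [expCoeff] at h2
  rw [integral_const_mul, h2, Int.cast_neg, ← sub_eq_add_neg, mul_assoc]

/-- A time-frequency shift of g becomes multiplication of G by a character, so a finite Gabor sum
becomes a trigonometric polynomial times G. -/
theorem norm_sum_gaborSystem (hG : IsQuasiPeriodic G) {g : Lp ℂ 2 (volume : Measure ℝ)}
    (hg : zakInv G =ᵐ[volume] g) (a : ℤ × ℤ →₀ ℂ) :
    ‖a.sum fun i c => c • gaborSystem g i‖ₑ =
      eLpNorm (fun z => trigPoly a z * Function.uncurry G z) 2 squareMeasure := by
  have h0 := (hG.trigPoly_mul a).eLpNorm_zakInv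
  have h1 : (fun z => trigPoly a z * Function.uncurry G z) =
    Function.uncurry fun x y => trigPoly a (x, y) * G x y := rfl
  rw [h1, ← h0, Lp.enorm_def]
  refine eLpNorm_congr_ae ?_
  have h2 := Lp.coeFn_finsetSum a.support fun i => a i • gaborSystem g i
  have h3 : ∀ᵐ x, ∀ i, (a i • gaborSystem g i : Lp ℂ 2 (volume : Measure ℝ)) x =
      a i * (unitExp (i.2 * x) * zakInv G (x - i.1)) := by
    rw [ae_all_iff]
    intro i
    have h4 : ∀ᵐ x : ℝ, zakInv G (x - i.1) = g (x - i.1) :=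
      (measurePreserving_sub_right volume (i.1 : ℝ)).quasiMeasurePreserving.ae hg
    filter_upwards [Lp.coeFn_smul (a i) (gaborSystem g i),
      (memLp_timeFreqShift (Lp.memLp g) i.1 i.2).coeFn_toLp, h4] with x h5 h6 h7
    rw [h5, Pi.smul_apply, gaborSystem, h6, h7, smul_eq_mul, timeFreqShift, unitExp]
    congr 3
    push_cast; ring
  filter_upwards [h2, h3, hG.zakInv_trigPoly_mul a] with x h4 h5 h6
  rw [h6, Finsupp.sum, h4, Finsupp.sum, Finset.sum_apply]
  exact Finset.sum_congr rfl fun i _ => h5 i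

end IsQuasiPeriodic

theorem IsRieszBasisWithBounds.finsupp_bounds {ι H : Type*} [NormedAddCommGroup H]
    [InnerProductSpace ℂ H] [CompleteSpace H] {A B : ℝ} {f : ι → H}
    (h : IsRieszBasisWithBounds A B f) (a : ι →₀ ℂ) :
    A * (a.sum fun _ c => ‖c‖ ^ 2) ≤ ‖a.sum fun i c => c • f i‖ ^ 2 ∧
      ‖a.sum fun i c => c • f i‖ ^ 2 ≤ B * (a.sum fun _ c => ‖c‖ ^ 2) := by
  have hmem : Memℓp (fun i => a i) 2 :=
    (memℓp_zero (a.hasFiniteSupport)).of_exponent_ge zero_le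
  have h1 := h.lower ⟨fun i => a i, hmem⟩
  have h2 := h.upper ⟨fun i => a i, hmem⟩
  have e1 : ∑' i, ‖a i‖ ^ 2 = a.sum fun _ c => ‖c‖ ^ 2 :=
    tsum_eq_sum fun i hi => by simp [Finsupp.notMem_support_iff.1 hi]
  have e2 : ∑' i, a i • f i = a.sum fun i c => c • f i :=
    tsum_eq_sum fun i hi => by simp [Finsupp.notMem_support_iff.1 hi]
  change A * ∑' i, ‖a i‖ ^ 2 ≤ ‖∑' i, a i • f i‖ ^ 2 at h1
  change ‖∑' i, a i • f i‖ ^ 2 ≤ B * ∑' i, ‖a i‖ ^ 2 at h2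
  rw [e1, e2] at h1 h2
  exact ⟨h1, h2⟩

theorem norm_sq_sum_planeExpLp (a : ℤ × ℤ →₀ ℂ) :
    ‖a.sum fun i c => c • planeExpLp i‖ ^ 2 = a.sum fun _ c => ‖c‖ ^ 2 := by
  have h := orthonormal_planeExpLp.inner_sum a a a.support
  rw [inner_self_eq_norm_sq_to_K] at h
  have h2 : ((‖∑ i ∈ a.support, a i • planeExpLp i‖ ^ 2 : ℝ) : ℂ) =
      ((∑ i ∈ a.support, ‖a i‖ ^ 2 : ℝ) : ℂ) := by
    push_cast
    refine Eq.trans ?_ (h.trans (Finset.sum_congr rfl fun i _ => ?_))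
    · rfl
    · rw [mul_comm, Complex.mul_conj, Complex.normSq_eq_norm_sq]; push_cast; rfl
  exact_mod_cast h2

theorem eLpNorm_trigPoly (a : ℤ × ℤ →₀ ℂ) : eLpNorm (trigPoly a) 2 squareMeasure =
    ENNReal.ofReal ‖a.sum fun i c => c • planeExpLp i‖ := by
  rw [ofReal_norm, Lp.enorm_def]
  exact (eLpNorm_congr_ae (coeFn_sum_planeExpLp a)).symm

/-- Pointwise convergence, obtained along a subsequence, is what Fatou's lemma needs in the upper
bound below. -/
theorem exists_seq_trigPoly {f : ℝ × ℝ → ℂ} (hf : MemLp f 2 squareMeasure) :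
    ∃ a : ℕ → ℤ × ℤ →₀ ℂ,
      Filter.Tendsto (fun n => eLpNorm (trigPoly (a n) - f) 2 squareMeasure)
        Filter.atTop (nhds 0) ∧
      ∀ᵐ z ∂squareMeasure, Filter.Tendsto (fun n => trigPoly (a n) z) Filter.atTop (nhds (f z)) := by
  have h1 : hf.toLp f ∈ closure (Submodule.span ℂ (Set.range planeExpLp) :
      Set (Lp ℂ 2 squareMeasure)) := by
    rw [← Submodule.topologicalClosure_coe, span_planeExpLp_closure]
    trivial
  obtain ⟨u, hu, hlim⟩ := mem_closure_iff_seq_limit.1 h1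
  choose a ha using fun n => Finsupp.mem_span_range_iff_exists_finsupp.1 (hu n)
  have h2 : Filter.Tendsto (fun n => eLpNorm (trigPoly (a n) - f) 2 squareMeasure)
      Filter.atTop (nhds 0) := by
    rw [Lp.tendsto_Lp_iff_tendsto_eLpNorm'] at hlim
    refine hlim.congr fun n => eLpNorm_congr_ae ?_
    rw [← ha]
    filter_upwards [coeFn_sum_planeExpLp (a n), hf.coeFn_toLp] with z h3 h4
    rw [Pi.sub_apply, Pi.sub_apply, h3, h4]
  have h3 := tendstoInMeasure_of_tendsto_eLpNorm two_ne_zero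
    (fun n => (continuous_trigPoly (a n)).aestronglyMeasurable) hf.aestronglyMeasurable h2
  obtain ⟨ns, hns, hae⟩ := h3.exists_seq_tendsto_ae
  exact ⟨fun n => a (ns n), h2.comp hns.tendsto_atTop, hae⟩

namespace IsQuasiPeriodic

variable {G : ℝ → ℝ → ℂ} {g : Lp ℂ 2 (volume : Measure ℝ)} {A B : ℝ}

theorem trigPoly_bounds (hG : IsQuasiPeriodic G) (hg : zakInv G =ᵐ[volume] g)
    (h : IsRieszBasisWithBounds A B (gaborSystem g)) (a : ℤ × ℤ →₀ ℂ) :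
    ENNReal.ofReal √A * eLpNorm (trigPoly a) 2 squareMeasure ≤
        eLpNorm (fun z => trigPoly a z * Function.uncurry G z) 2 squareMeasure ∧
      eLpNorm (fun z => trigPoly a z * Function.uncurry G z) 2 squareMeasure ≤
        ENNReal.ofReal √B * eLpNorm (trigPoly a) 2 squareMeasure := by
  obtain ⟨h1, h2⟩ := h.finsupp_bounds a
  rw [← norm_sq_sum_planeExpLp] at h1 h2
  rw [← hG.norm_sum_gaborSystem hg, eLpNorm_trigPoly, ← ENNReal.ofReal_mul (Real.sqrt_nonneg _),
    ← ENNReal.ofReal_mul (Real.sqrt_nonneg _), ← ofReal_norm]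
  constructor
  · refine ENNReal.ofReal_le_ofReal (abs_le_of_sq_le_sq' ?_ (norm_nonneg _)).2
    rwa [mul_pow, Real.sq_sqrt h.lower_pos.le]
  · refine ENNReal.ofReal_le_ofReal (abs_le_of_sq_le_sq' ?_ (by positivity)).2
    rwa [mul_pow, Real.sq_sqrt h.upper_pos.le]

/-- The product f G is not yet known to be square-integrable, so the bound passes from polynomials
to f by Fatou's lemma. -/
theorem eLpNorm_mul_le (hG : IsQuasiPeriodic G) (hg : zakInv G =ᵐ[volume] g)
    (h : IsRieszBasisWithBounds A B (gaborSystem g)) {f : ℝ × ℝ → ℂ}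
    (hf : MemLp f 2 squareMeasure) :
    eLpNorm (fun z => f z * Function.uncurry G z) 2 squareMeasure ≤
      ENNReal.ofReal √B * eLpNorm f 2 squareMeasure := by
  obtain ⟨a, ha, hae⟩ := exists_seq_trigPoly hf
  have h1 : eLpNorm (fun z => f z * Function.uncurry G z) 2 squareMeasure ≤
      Filter.liminf (fun n => eLpNorm (fun z => trigPoly (a n) z * Function.uncurry G z) 2
        squareMeasure) Filter.atTop := by
    refine Lp.eLpNorm_lim_le_liminf_eLpNorm
      (fun n => ((hG.trigPoly_mul (a n)).measurable).aestronglyMeasurable) _ ?_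
    filter_upwards [hae] with z hz
    exact hz.mul_const _
  have h2 : Filter.Tendsto (fun n => ENNReal.ofReal √B * (eLpNorm f 2 squareMeasure +
      eLpNorm (trigPoly (a n) - f) 2 squareMeasure)) Filter.atTop
      (nhds (ENNReal.ofReal √B * (eLpNorm f 2 squareMeasure + 0))) :=
    ENNReal.Tendsto.const_mul (ha.const_add _) (Or.inr ENNReal.ofReal_ne_top)
  rw [add_zero] at h2
  refine h1.trans (le_trans (Filter.liminf_le_liminf (Filter.Eventually.of_forall fun n => ?_))
    h2.liminf_eq.le)
  refine (hG.trigPoly_bounds hg h (a n)).2.trans ?_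
  gcongr
  calc eLpNorm (trigPoly (a n)) 2 squareMeasure
      = eLpNorm (f + (trigPoly (a n) - f)) 2 squareMeasure := by rw [add_sub_cancel]
    _ ≤ _ := eLpNorm_add_le hf.aestronglyMeasurable
      ((continuous_trigPoly (a n)).aestronglyMeasurable.sub hf.aestronglyMeasurable) one_le_two

/-- The upper bound makes multiplication by G continuous on L², so the lower bound passes to norm
limits of polynomials. -/
theorem le_eLpNorm_mul (hG : IsQuasiPeriodic G) (hg : zakInv G =ᵐ[volume] g)
    (h : IsRieszBasisWithBounds A B (gaborSystem g)) {f : ℝ × ℝ → ℂ}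
    (hf : MemLp f 2 squareMeasure) :
    ENNReal.ofReal √A * eLpNorm f 2 squareMeasure ≤
      eLpNorm (fun z => f z * Function.uncurry G z) 2 squareMeasure := by
  obtain ⟨a, ha, -⟩ := exists_seq_trigPoly hf
  set e : ℕ → ℝ≥0∞ := fun n => eLpNorm (trigPoly (a n) - f) 2 squareMeasure with he
  have h2 : Filter.Tendsto (fun n => eLpNorm (fun z => f z * Function.uncurry G z) 2 squareMeasure +
      (ENNReal.ofReal √B * e n + ENNReal.ofReal √A * e n)) Filter.atTop
      (nhds (eLpNorm (fun z => f z * Function.uncurry G z) 2 squareMeasure +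
        (ENNReal.ofReal √B * 0 + ENNReal.ofReal √A * 0))) :=
    ((ENNReal.Tendsto.const_mul ha (Or.inr ENNReal.ofReal_ne_top)).add
      (ENNReal.Tendsto.const_mul ha (Or.inr ENNReal.ofReal_ne_top))).const_add _
  rw [mul_zero, mul_zero, add_zero, add_zero] at h2
  refine ge_of_tendsto' h2 fun n => ?_
  have hdm : MemLp (trigPoly (a n) - f) 2 squareMeasure :=
    (MemLp.of_bound (continuous_trigPoly (a n)).aestronglyMeasurable _
      (Filter.Eventually.of_forall (norm_trigPoly_le (a n)))).sub hf
  have h3 : eLpNorm f 2 squareMeasure ≤ eLpNorm (trigPoly (a n)) 2 squareMeasure + e n := by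
    calc eLpNorm f 2 squareMeasure
        = eLpNorm (trigPoly (a n) - (trigPoly (a n) - f)) 2 squareMeasure := by rw [sub_sub_cancel]
      _ ≤ _ := eLpNorm_sub_le (continuous_trigPoly (a n)).aestronglyMeasurable
        hdm.aestronglyMeasurable one_le_two
  have h4 : eLpNorm (fun z => trigPoly (a n) z * Function.uncurry G z) 2 squareMeasure ≤
      eLpNorm (fun z => f z * Function.uncurry G z) 2 squareMeasure + ENNReal.ofReal √B * e n := by
    calc _ = eLpNorm ((fun z => f z * Function.uncurry G z) +
          fun z => (trigPoly (a n) - f) z * Function.uncurry G z) 2 squareMeasure := by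
          congr 1; ext z; simp only [Pi.add_apply, Pi.sub_apply]; ring
      _ ≤ _ := eLpNorm_add_le (hf.aestronglyMeasurable.mul hG.memLp.aestronglyMeasurable)
          (hdm.aestronglyMeasurable.mul hG.memLp.aestronglyMeasurable) one_le_two
      _ ≤ _ := by gcongr; exact hG.eLpNorm_mul_le hg h hdm
  calc ENNReal.ofReal √A * eLpNorm f 2 squareMeasure
      ≤ ENNReal.ofReal √A * (eLpNorm (trigPoly (a n)) 2 squareMeasure + e n) := by gcongr
    _ = ENNReal.ofReal √A * eLpNorm (trigPoly (a n)) 2 squareMeasure +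
        ENNReal.ofReal √A * e n := mul_add _ _ _
    _ ≤ _ := by
      rw [← add_assoc]
      gcongr
      exact (hG.trigPoly_bounds hg h (a n)).1.trans h4

theorem eLpNorm_indicator_one_sq {s : Set (ℝ × ℝ)} (hs : MeasurableSet s) :
    eLpNorm (s.indicator fun _ => (1 : ℂ)) 2 squareMeasure ^ 2 = squareMeasure s := by
  rw [eLpNorm_indicator_const hs two_ne_zero ENNReal.ofNat_ne_top, enorm_one, one_mul,
    ← ENNReal.rpow_natCast, ← ENNReal.rpow_mul]
  norm_num

theorem eLpNorm_indicator_mul_sq {s : Set (ℝ × ℝ)}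
    (hs : MeasurableSet s) :
    eLpNorm (fun z => s.indicator (fun _ => (1 : ℂ)) z * Function.uncurry G z) 2 squareMeasure ^ 2 =
      ∫⁻ z in s, ‖Function.uncurry G z‖ₑ ^ 2 ∂squareMeasure := by
  rw [eLpNorm_eq_lintegral_rpow_enorm_toReal two_ne_zero ENNReal.ofNat_ne_top,
    ← ENNReal.rpow_natCast, ← ENNReal.rpow_mul, ← lintegral_indicator hs]
  norm_num
  refine lintegral_congr fun z => ?_
  by_cases hz : z ∈ s <;> simp [hz]

/-- The Zak transform of the window of a Gabor Riesz basis is bounded above and below. -/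
theorem ae_bounds (hG : IsQuasiPeriodic G) (hg : zakInv G =ᵐ[volume] g)
    (h : IsRieszBasisWithBounds A B (gaborSystem g)) :
    ∀ᵐ z ∂squareMeasure, √A ≤ ‖Function.uncurry G z‖ ∧ ‖Function.uncurry G z‖ ≤ √B := by
  have hsq : ∀ C : ℝ, 0 ≤ C → ENNReal.ofReal √C ^ 2 = ENNReal.ofReal C := fun C hC => by
    rw [← ENNReal.ofReal_pow (Real.sqrt_nonneg _), Real.sq_sqrt hC]
  have hmem : ∀ {s : Set (ℝ × ℝ)}, MeasurableSet s →
      MemLp (s.indicator fun _ => (1 : ℂ)) 2 squareMeasure := fun hs =>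
    memLp_indicator_const 2 hs 1 (Or.inr (measure_ne_top _ _))
  have hm : Measurable fun z => ‖Function.uncurry G z‖ₑ ^ 2 := hG.measurable.enorm.pow_const 2
  -- Testing with f the indicator of s compares the integral of |G|² over s with B times the measure
  -- of s, for every measurable s.
  have h1 : (fun z => ‖Function.uncurry G z‖ₑ ^ 2) ≤ᵐ[squareMeasure] fun _ => ENNReal.ofReal B := by
    refine ae_le_of_forall_setLIntegral_le_of_sigmaFinite hm fun s hs _ => ?_
    have h2 := pow_le_pow_left₀ zero_le (hG.eLpNorm_mul_le hg h (hmem hs)) 2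
    rw [eLpNorm_indicator_mul_sq (G := G) hs, mul_pow, eLpNorm_indicator_one_sq hs,
      hsq B h.upper_pos.le] at h2
    rwa [setLIntegral_const]
  have h2 : (fun _ => ENNReal.ofReal A) ≤ᵐ[squareMeasure] fun z => ‖Function.uncurry G z‖ₑ ^ 2 := by
    refine ae_le_of_forall_setLIntegral_le_of_sigmaFinite measurable_const fun s hs _ => ?_
    have h2 := pow_le_pow_left₀ zero_le (hG.le_eLpNorm_mul hg h (hmem hs)) 2
    rw [eLpNorm_indicator_mul_sq (G := G) hs, mul_pow, eLpNorm_indicator_one_sq hs,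
      hsq A h.lower_pos.le] at h2
    rwa [setLIntegral_const]
  filter_upwards [h1, h2] with z h3 h4
  rw [← ofReal_norm, ← ENNReal.ofReal_pow (norm_nonneg _)] at h3 h4
  constructor
  · rw [ENNReal.ofReal_le_ofReal_iff (by positivity)] at h4
    exact Real.sqrt_le_iff.2 ⟨norm_nonneg _, h4⟩
  · rw [ENNReal.ofReal_le_ofReal_iff h.upper_pos.le] at h3
    exact Real.le_sqrt_of_sq_le h3

end IsQuasiPeriodic

/-! ### The discrete winding argument -/

theorem Real.Angle.eq_of_coe_eq_of_abs_sub_lt {s t : ℝ} (h : (s : Real.Angle) = t)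
    (hst : |s - t| < 2 * Real.pi) : s = t := by
  obtain ⟨n, hn⟩ := Real.Angle.angle_eq_iff_two_pi_dvd_sub.1 h
  rw [hn, abs_mul, abs_of_pos Real.two_pi_pos] at hst
  have h1 : |(n : ℝ)| < 1 := by
    by_contra hc
    nlinarith [Real.two_pi_pos, not_lt.1 hc]
  have h2 : n = 0 := by
    rw [← Int.abs_lt_one_iff]; exact_mod_cast h1
  rw [h2, Int.cast_zero, mul_zero] at hn
  linarith

theorem coe_arg_unitExp (t : ℝ) :
    ((unitExp t).arg : Real.Angle) = ((2 * Real.pi * t : ℝ) : Real.Angle) := by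
  rw [unitExp, Complex.arg_exp_mul_I, Real.Angle.coe_toIocMod]

/-- A nonvanishing array with the boundary behaviour of a quasi-periodic function has a large
argument increment. -/
theorem false_of_small_increments (F : ℕ → ℕ → ℂ) (K M : ℕ) (w : ℝ) (hM : 2 ≤ M)
    (hne : ∀ i j, F i j ≠ 0)
    (h1 : ∀ i < K, ∀ j ≤ M, |(F (i + 1) j / F i j).arg| < Real.pi / 2)
    (h2 : ∀ i ≤ K, ∀ j < M, |(F i (j + 1) / F i j).arg| < Real.pi / 2)
    (hper : ∀ i, F i M = F i 0)
    (htw : ∀ j, F K j = unitExp (w + j / M) * F 0 j) : False := by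
  set a : ℕ → ℕ → ℝ := fun i j => (F (i + 1) j / F i j).arg with ha
  set b : ℕ → ℕ → ℝ := fun i j => (F i (j + 1) / F i j).arg with hb
  have hM0 : (0 : ℝ) < M := by positivity
  have hang : ∀ x y : ℂ, x ≠ 0 → y ≠ 0 →
      (((x / y).arg : ℝ) : Real.Angle) = x.arg - y.arg := fun x y hx hy =>
    Complex.arg_div_coe_angle hx hy
  -- No winding inside a cell: the four increments around it sum to a multiple of 2π, and each is
  -- below π/2 in absolute value.
  have hcell : ∀ j < M, ∀ i < K, a i (j + 1) - a i j = b (i + 1) j - b i j := by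
    intro j hj i hi
    have e : a i (j + 1) + b i j = b (i + 1) j + a i j := by
      apply Real.Angle.eq_of_coe_eq_of_abs_sub_lt
      · simp only [ha, hb, Real.Angle.coe_add, hang _ _ (hne _ _) (hne _ _)]
        abel
      · have b1 := abs_lt.1 (h1 i hi (j + 1) hj)
        have b2 := abs_lt.1 (h1 i hi j hj.le)
        have b3 := abs_lt.1 (h2 i hi.le j hj)
        have b4 := abs_lt.1 (h2 (i + 1) hi j hj)
        simp only [ha, hb]
        rw [abs_lt]
        constructor <;> linarith
    linarith
  -- The twist makes each vertical increment in column K exceed that in column 0 by 2π/M, modulo 2π.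
  -- As M ≥ 2, this shift is at most π, so the congruence is an equality.
  have hb0 : ∀ j < M, b K j - b 0 j = 2 * Real.pi / M := by
    intro j hj
    have e : b K j = 2 * Real.pi / M + b 0 j := by
      apply Real.Angle.eq_of_coe_eq_of_abs_sub_lt
      · have h3 : F K (j + 1) / F K j = unitExp (1 / M) * (F 0 (j + 1) / F 0 j) := by
          rw [htw, htw, mul_div_mul_comm]
          congr 1
          rw [div_eq_iff (unitExp_ne_zero _), ← unitExp_add]
          congr 1
          push_cast
          ring
        simp only [hb, h3]
        rw [Complex.arg_mul_coe_angle (unitExp_ne_zero _) (div_ne_zero (hne _ _) (hne _ _)),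
          coe_arg_unitExp, Real.Angle.coe_add]
        congr 3
        ring
      · have b3 := abs_lt.1 (h2 0 (Nat.zero_le _) j hj)
        have b4 := abs_lt.1 (h2 K le_rfl j hj)
        have h5 : 2 * Real.pi / M ≤ Real.pi := by
          rw [div_le_iff₀ hM0]
          have : (2 : ℝ) ≤ M := by exact_mod_cast hM
          nlinarith [Real.pi_pos]
        have h6 : 0 < 2 * Real.pi / M := by positivity
        simp only [hb]
        rw [abs_lt]
        constructor <;> linarith
    linarith
  -- Summing a row of cells, the total horizontal increment grows by 2π/M per row, hence by 2π over
  -- M rows; yet row M equals row 0.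
  have hstep : ∀ j < M, (∑ i ∈ Finset.range K, a i (j + 1)) - ∑ i ∈ Finset.range K, a i j =
      2 * Real.pi / M := by
    intro j hj
    rw [← Finset.sum_sub_distrib, ← hb0 j hj, ← Finset.sum_range_sub (fun i => b i j)]
    exact Finset.sum_congr rfl fun i hi => hcell j hj i (Finset.mem_range.1 hi)
  have htot := Finset.sum_range_sub (fun j => ∑ i ∈ Finset.range K, a i j) M
  rw [Finset.sum_congr rfl fun j hj => hstep j (Finset.mem_range.1 hj), Finset.sum_const,
    Finset.card_range, nsmul_eq_mul] at htot
  have hend : (∑ i ∈ Finset.range K, a i M) = ∑ i ∈ Finset.range K, a i 0 :=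
    Finset.sum_congr rfl fun i _ => by simp only [ha, hper]
  rw [hend, sub_self] at htot
  have : (M : ℝ) * (2 * Real.pi / M) = 2 * Real.pi := by field_simp
  linarith [Real.pi_pos]

theorem abs_arg_div_lt {x y : ℂ} {c : ℝ} (hy : c ≤ ‖y‖) (hxy : ‖x - y‖ < c) :
    |(x / y).arg| < Real.pi / 2 := by
  have hy0 : 0 < ‖y‖ := (norm_nonneg _).trans_lt (hxy.trans_le hy)
  rw [Complex.abs_arg_lt_pi_div_two_iff]
  left
  have h1 : ‖x / y - 1‖ < 1 := by
    rw [div_sub_one (norm_pos_iff.1 hy0), norm_div, div_lt_one hy0]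
    exact hxy.trans_le hy
  have h2 := (Complex.abs_re_le_norm (x / y - 1)).trans_lt h1
  rw [Complex.sub_re, Complex.one_re, abs_lt] at h2
  linarith

namespace IsQuasiPeriodic

variable {G : ℝ → ℝ → ℂ}

/-- Without jumps all neighbouring ratios lie in the right half-plane, which the winding argument
forbids. Bounds on one period of the grid suffice, since moduli are periodic. -/
theorem exists_jump (hG : IsQuasiPeriodic G) {α β δ : ℝ} (hδ : 0 < δ) (hδα : 2 * δ ≤ α)
    {K M : ℕ} (hK : 0 < K) (hM : 2 ≤ M) (hMβ : 2 * Real.pi * (1 / M) * β ≤ δ) (u v : ℝ)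
    (hlow : ∀ i < K, ∀ j < M, α ≤ ‖G (u + i / K) (v + j / M)‖)
    (hup : ∀ i < K, ∀ j < M, ‖G (u + i / K) (v + j / M)‖ ≤ β) :
    ∃ i < K, ∃ j < M,
      δ ≤ ‖G (u + i / K + 1 / K) (v + j / M) - G (u + i / K) (v + j / M)‖ ∨
      δ ≤ ‖G (u + i / K) (v + j / M + 1 / M) - G (u + i / K) (v + j / M)‖ := by
  by_contra! hcon
  have hK0 : (K : ℝ) ≠ 0 := by positivity
  have hM0 : (M : ℝ) ≠ 0 := by positivity
  have hα : 0 < α := by linarith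
  have hβ : 0 ≤ β := (norm_nonneg _).trans (hup 0 hK 0 (by omega))
  set F : ℕ → ℕ → ℂ := fun i j => G (u + i / K) (v + j / M) with hF
  have hperj : ∀ i j, F i (j + M) = F i j := by
    intro i j
    have : v + ((j + M : ℕ) : ℝ) / M = v + j / M + 1 := by push_cast; field_simp; ring
    simp only [hF, this, hG.add_one_right]
  have htwi : ∀ i j, F (i + K) j = unitExp (v + j / M) * F i j := by
    intro i j
    have : u + ((i + K : ℕ) : ℝ) / K = u + i / K + 1 := by push_cast; field_simp; ring
    simp only [hF, this, hG.add_one_left]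
  have hnormi : ∀ i j, ‖F i j‖ = ‖F (i % K) j‖ := by
    intro i j
    induction i using Nat.strong_induction_on with
    | _ i ih =>
      rcases lt_or_ge i K with h | h
      · rw [Nat.mod_eq_of_lt h]
      · obtain ⟨k, rfl⟩ := Nat.exists_eq_add_of_le' h
        rw [htwi, norm_mul, norm_unitExp, one_mul, Nat.add_mod_right]
        exact ih k (by omega)
  have hmodj : ∀ i j, F i j = F i (j % M) := by
    intro i j
    induction j using Nat.strong_induction_on with
    | _ j ih =>
      rcases lt_or_ge j M with h | h
      · rw [Nat.mod_eq_of_lt h]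
      · obtain ⟨k, rfl⟩ := Nat.exists_eq_add_of_le' h
        rw [hperj, Nat.add_mod_right]
        exact ih k (by omega)
  have hlow' : ∀ i j, α ≤ ‖F i j‖ := fun i j => by
    rw [hnormi, hmodj]
    exact hlow _ (Nat.mod_lt _ hK) _ (Nat.mod_lt _ (by omega))
  have hup' : ∀ i j, ‖F i j‖ ≤ β := fun i j => by
    rw [hnormi, hmodj]
    exact hup _ (Nat.mod_lt _ hK) _ (Nat.mod_lt _ (by omega))
  have hh : ∀ i < K, ∀ j, ‖F (i + 1) j - F i j‖ < δ := by
    intro i hi j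
    have h1 := (hcon i hi (j % M) (Nat.mod_lt _ (by omega))).1
    have e : u + ((i + 1 : ℕ) : ℝ) / K = u + i / K + 1 / K := by push_cast; ring
    rw [hmodj (i + 1) j, hmodj i j]
    simp only [hF, e]
    exact h1
  have hv : ∀ i < K, ∀ j < M, ‖F i (j + 1) - F i j‖ < δ := by
    intro i hi j hj
    have h1 := (hcon i hi j hj).2
    have e : v + ((j + 1 : ℕ) : ℝ) / M = v + j / M + 1 / M := by push_cast; ring
    simp only [hF, e]
    exact h1
  refine false_of_small_increments F K M v hM
    (fun i j => norm_pos_iff.1 (hα.trans_le (hlow' i j))) (fun i hi j _ => ?_)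
    (fun i hi j hj => ?_) (fun i => ?_) (fun j => ?_)
  · exact abs_arg_div_lt (hlow' i j) ((hh i hi j).trans (by linarith))
  · rcases hi.lt_or_eq with hi | rfl
    · exact abs_arg_div_lt (hlow' i j) ((hv i hi j hj).trans (by linarith))
    -- Column K is column 0 twisted by a character that varies with j. The variation costs 2πβ/M ≤ δ
    -- on top of an increment below δ, whence the condition 2δ ≤ α.
    · refine abs_arg_div_lt (hlow' i j) ?_
      have e0 := htwi 0 j
      have e1 := htwi 0 (j + 1)
      rw [zero_add] at e0 e1
      have e2 : v + ((j + 1 : ℕ) : ℝ) / M = v + j / M + 1 / M := by push_cast; ring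
      rw [e0, e1, e2, unitExp_add, mul_assoc, ← mul_sub, norm_mul, norm_unitExp, one_mul]
      calc ‖unitExp (1 / M) * F 0 (j + 1) - F 0 j‖
          = ‖(F 0 (j + 1) - F 0 j) + (unitExp (1 / M) - 1) * F 0 (j + 1)‖ := by congr 1; ring
        _ ≤ ‖F 0 (j + 1) - F 0 j‖ + ‖unitExp (1 / M) - 1‖ * ‖F 0 (j + 1)‖ := by
          rw [← norm_mul]; exact norm_add_le _ _
        _ ≤ ‖F 0 (j + 1) - F 0 j‖ + (2 * Real.pi * (1 / M)) * β := by
          gcongr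
          · exact (norm_unitExp_sub_one_le _).trans (by rw [abs_of_nonneg (by positivity)])
          · exact hup' _ _
        _ < α := by linarith [hv 0 hK j hj]
  · have := hperj i 0
    rwa [zero_add] at this
  · have := htwi 0 j
    rwa [zero_add] at this

end IsQuasiPeriodic

/-! ### Averaging over translates of the grid -/

theorem lintegral_Ioc_natMul (f : ℝ → ℝ≥0∞) {s : ℝ} (hs : 0 ≤ s) (n : ℕ) :
    ∫⁻ x in Set.Ioc 0 (n * s), f x =
      ∑ i ∈ Finset.range n, ∫⁻ x in Set.Ioc 0 s, f (x + i * s) := by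
  induction n with
  | zero => simp
  | succ n ih =>
    have h1 : Set.Ioc 0 (((n + 1 : ℕ) : ℝ) * s) =
        Set.Ioc 0 (n * s) ∪ Set.Ioc (n * s) (((n + 1 : ℕ) : ℝ) * s) := by
      rw [Set.Ioc_union_Ioc_eq_Ioc (by positivity)]
      push_cast
      linarith
    have h2 : ∫⁻ x in Set.Ioc (n * s) (((n + 1 : ℕ) : ℝ) * s), f x =
        ∫⁻ x in Set.Ioc 0 s, f (x + n * s) := by
      rw [(measurePreserving_add_right volume ((n : ℝ) * s)).setLIntegral_comp_emb
        (measurableEmbedding_addRight _) f (Set.Ioc 0 s)]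
      congr 2
      simp
      ring_nf
    rw [h1, lintegral_union measurableSet_Ioc, ih, h2, Finset.sum_range_succ]
    exact Set.Ioc_disjoint_Ioc_of_le le_rfl

theorem lintegral_unit_subdivide (f : ℝ → ℝ≥0∞) {n : ℕ} (hn : 0 < n) :
    ∫⁻ x, f x ∂unitMeasure =
      ∑ i ∈ Finset.range n, ∫⁻ x in Set.Ioc 0 (1 / (n : ℝ)), f (x + i / n) := by
  have h := lintegral_Ioc_natMul f (s := 1 / (n : ℝ)) (by positivity) n
  rw [mul_one_div_cancel (by positivity)] at h
  simpa only [mul_one_div] using h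

/-- The integral over the square is the integral of the grid sum over offsets (u, v) in one cell of
area 1/(KM), and each grid sum is at least 1. -/
theorem inv_mul_le_lintegral_square {T : ℝ × ℝ → ℝ≥0∞} (hT : Measurable T) {K M : ℕ} (hK : 0 < K)
    (hM : 0 < M) (h : ∀ u v : ℝ, u ∈ Set.Ioc 0 (1 / (K : ℝ)) → v ∈ Set.Ioc 0 (1 / (M : ℝ)) →
      ∃ i < K, ∃ j < M, 1 ≤ T (u + i / K, v + j / M)) :
    ENNReal.ofReal (1 / (K * M)) ≤ ∫⁻ z, T z ∂squareMeasure := by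
  have hm1 : ∀ i : ℕ, Measurable fun u : ℝ => ∫⁻ y, T (u + i / K, y) ∂unitMeasure := fun i =>
    hT.lintegral_prod_right'.comp (measurable_id.add_const _)
  rw [lintegral_prod _ hT.aemeasurable, lintegral_unit_subdivide _ hK,
    ← lintegral_finsetSum _ fun i _ => hm1 i]
  have hin : ∀ u ∈ Set.Ioc 0 (1 / (K : ℝ)), ENNReal.ofReal (1 / M) ≤
      ∑ i ∈ Finset.range K, ∫⁻ y, T (u + i / K, y) ∂unitMeasure := by
    intro u hu
    have h1 : ∀ i ∈ Finset.range K, ∫⁻ y, T (u + i / K, y) ∂unitMeasure =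
        ∫⁻ v in Set.Ioc 0 (1 / (M : ℝ)), ∑ j ∈ Finset.range M, T (u + i / K, v + j / M) := by
      intro i _
      rw [lintegral_unit_subdivide _ hM, lintegral_finsetSum]
      intro j _
      exact hT.comp (measurable_const.prodMk (measurable_id.add_const _))
    rw [Finset.sum_congr rfl h1, ← lintegral_finsetSum]
    · have h2 : ∫⁻ v in Set.Ioc 0 (1 / (M : ℝ)), 1 = ENNReal.ofReal (1 / M) := by simp
      rw [← h2]
      refine setLIntegral_mono' measurableSet_Ioc fun v hv => ?_
      obtain ⟨i, hi, j, hj, hij⟩ := h u v hu hv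
      refine hij.trans ?_
      refine le_trans ?_ (Finset.single_le_sum
        (f := fun i : ℕ => ∑ j ∈ Finset.range M, T (u + i / K, v + j / M))
        (fun _ _ => zero_le) (Finset.mem_range.2 hi))
      exact Finset.single_le_sum (f := fun j : ℕ => T (u + i / K, v + j / M))
        (fun _ _ => zero_le) (Finset.mem_range.2 hj)
    · intro i _
      exact Finset.measurable_sum _ fun j _ =>
        hT.comp (measurable_const.prodMk (measurable_id.add_const _))
  calc ENNReal.ofReal (1 / (K * M)) = ∫⁻ u in Set.Ioc 0 (1 / (K : ℝ)), ENNReal.ofReal (1 / M) := by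
        rw [setLIntegral_const, Real.volume_Ioc, sub_zero, ← ENNReal.ofReal_mul (by positivity)]
        congr 1; field_simp
    _ ≤ _ := setLIntegral_mono' measurableSet_Ioc hin

theorem IsQuasiPeriodic.inv_mul_le_measure_jump {G : ℝ → ℝ → ℂ} (hG : IsQuasiPeriodic G)
    {α β δ : ℝ} (hδ : 0 < δ) (hδα : 2 * δ ≤ α) {K M : ℕ} (hK : 0 < K) (hM : 2 ≤ M)
    (hMβ : 2 * Real.pi * (1 / M) * β ≤ δ)
    (hb : ∀ᵐ z ∂squareMeasure, α ≤ ‖Function.uncurry G z‖ ∧ ‖Function.uncurry G z‖ ≤ β) :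
    ENNReal.ofReal (1 / (K * M)) ≤
      squareMeasure {z | δ ≤ ‖G (z.1 + 1 / K) z.2 - G z.1 z.2‖} +
        squareMeasure {z | δ ≤ ‖G z.1 (z.2 + 1 / M) - G z.1 z.2‖} := by
  set E1 := {z : ℝ × ℝ | δ ≤ ‖G (z.1 + 1 / K) z.2 - G z.1 z.2‖} with hE1
  set E2 := {z : ℝ × ℝ | δ ≤ ‖G z.1 (z.2 + 1 / M) - G z.1 z.2‖} with hE2
  -- Adding this null set to the counting function lets the grid lemma be applied at every offset,
  -- including those whose grid meets a bad point.
  set E3 := {z : ℝ × ℝ | ¬(α ≤ ‖Function.uncurry G z‖ ∧ ‖Function.uncurry G z‖ ≤ β)} with hE3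
  have hm1 : MeasurableSet E1 := by
    have h1 : Measurable fun z : ℝ × ℝ => G (z.1 + 1 / K) z.2 :=
      hG.measurable.comp ((measurable_fst.add_const _).prodMk measurable_snd)
    exact measurableSet_le measurable_const (h1.sub hG.measurable).norm
  have hm2 : MeasurableSet E2 := by
    have h1 : Measurable fun z : ℝ × ℝ => G z.1 (z.2 + 1 / M) :=
      hG.measurable.comp (measurable_fst.prodMk (measurable_snd.add_const _))
    exact measurableSet_le measurable_const (h1.sub hG.measurable).norm
  have hm3 : MeasurableSet E3 :=
    ((measurableSet_le measurable_const hG.measurable.norm).inter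
      (measurableSet_le hG.measurable.norm measurable_const)).compl
  have h3 : squareMeasure E3 = 0 := hb
  have hT := inv_mul_le_lintegral_square (T := fun z => E1.indicator 1 z + E2.indicator 1 z +
    E3.indicator 1 z) (((measurable_one.indicator hm1).add (measurable_one.indicator hm2)).add
      (measurable_one.indicator hm3)) hK (by omega : 0 < M) fun u v _ _ => by
    by_cases hbad : ∃ i < K, ∃ j < M, (u + i / K, v + j / M) ∈ E3
    · obtain ⟨i, hi, j, hj, hij⟩ := hbad
      refine ⟨i, hi, j, hj, ?_⟩
      rw [Set.indicator_of_mem hij]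
      exact le_add_self
    · push Not at hbad
      have hgood : ∀ i < K, ∀ j < M, α ≤ ‖G (u + i / K) (v + j / M)‖ ∧
          ‖G (u + i / K) (v + j / M)‖ ≤ β := fun i hi j hj => not_not.1 (hbad i hi j hj)
      obtain ⟨i, hi, j, hj, hij⟩ := hG.exists_jump hδ hδα hK hM hMβ u v
        (fun i hi j hj => (hgood i hi j hj).1) (fun i hi j hj => (hgood i hi j hj).2)
      refine ⟨i, hi, j, hj, ?_⟩
      rcases hij with h | h
      · rw [Set.indicator_of_mem (show _ ∈ E1 from h), add_assoc]
        exact le_self_add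
      · rw [Set.indicator_of_mem (show _ ∈ E2 from h), add_right_comm]
        exact le_add_self
  rw [lintegral_add_right _ (measurable_one.indicator hm3),
    lintegral_add_right _ (measurable_one.indicator hm2), lintegral_indicator_one hm1,
    lintegral_indicator_one hm2, lintegral_indicator_one hm3, h3, add_zero] at hT
  exact hT

/-! ### Jump sets bounded by amalgam tails -/

theorem lintegral_sum_rpow_le {α ι : Type*} [MeasurableSpace α] {μ : Measure α}
    {f : ι → α → ℝ≥0∞} (hf : ∀ i, AEMeasurable (f i) μ) {r : ℝ} (hr : 1 ≤ r) (s : Finset ι) :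
    (∫⁻ x, (∑ i ∈ s, f i x) ^ r ∂μ) ^ (1 / r) ≤ ∑ i ∈ s, (∫⁻ x, f i x ^ r ∂μ) ^ (1 / r) := by
  classical
  have hr0 : 0 < r := by linarith
  induction s using Finset.induction_on with
  | empty => simp [hr0]
  | insert i s hi ih =>
    simp only [Finset.sum_insert hi]
    refine le_trans ?_ (add_le_add_right ih _)
    exact ENNReal.lintegral_Lp_add_le (hf i) (Finset.aemeasurable_fun_sum s fun i _ => hf i) hr

/-- The Minkowski inequality for countable sums. -/
theorem lintegral_tsum_rpow_le {α ι : Type*} [Countable ι] [MeasurableSpace α] {μ : Measure α}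
    {f : ι → α → ℝ≥0∞} (hf : ∀ i, AEMeasurable (f i) μ) {r : ℝ} (hr : 1 ≤ r) :
    ∫⁻ x, (∑' i, f i x) ^ r ∂μ ≤ (∑' i, (∫⁻ x, f i x ^ r ∂μ) ^ (1 / r)) ^ r := by
  classical
  have hr0 : 0 < r := by linarith
  have h1 : ∀ x, (∑' i, f i x) ^ r = ⨆ s : Finset ι, (∑ i ∈ s, f i x) ^ r := by
    intro x
    rw [ENNReal.tsum_eq_iSup_sum]
    exact (ENNReal.orderIsoRpow r hr0).map_iSup _
  simp_rw [h1]
  rw [lintegral_iSup_directed]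
  · refine iSup_le fun s => ?_
    have h2 := ENNReal.rpow_le_rpow ((lintegral_sum_rpow_le hf hr s).trans
      (ENNReal.sum_le_tsum s)) hr0.le
    rwa [← ENNReal.rpow_mul, one_div_mul_cancel hr0.ne', ENNReal.rpow_one] at h2
  · exact fun s => (Finset.aemeasurable_fun_sum s fun i _ => hf i).pow_const r
  · refine Monotone.directed_le fun s t hst x => ?_
    exact ENNReal.rpow_le_rpow (Finset.sum_le_sum_of_subset hst) hr0.le

theorem unitIntervalNorm_eq (q : ℝ≥0∞) {f : ℝ → ℂ} (hf : AEStronglyMeasurable f volume) (k : ℤ) :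
    unitIntervalNorm q f k = eLpNorm (fun x => f (x + k)) q unitMeasure := by
  have h : MeasurePreserving (fun x : ℝ => x + k) unitMeasure
      (volume.restrict (Set.Ioc (k : ℝ) (k + 1))) := by
    have := (measurePreserving_add_right volume (k : ℝ)).restrict_preimage
      (measurableSet_Ioc : MeasurableSet (Set.Ioc (k : ℝ) (k + 1)))
    simpa using this
  rw [unitIntervalNorm, restrict_Ioo_eq_restrict_Ioc]
  exact (eLpNorm_comp_measurePreserving hf.restrict h).symm

theorem unitIntervalNorm_congr {q : ℝ≥0∞} {f g : ℝ → ℂ} (h : ∀ x, ‖f x‖ = ‖g x‖) (k : ℤ) :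
    unitIntervalNorm q f k = unitIntervalNorm q g k :=
  eLpNorm_congr_norm_ae (Filter.Eventually.of_forall h)

/-- With r = 1/(p - 1) and q = p/(p - 1) one has q = pr and p/q = 1/r, the form in which Minkowski's
inequality delivers the norm. -/
theorem unitIntervalNorm_rpow {p : ℝ} (hp : 1 < p) (f : ℝ → ℂ)
    (hf : AEStronglyMeasurable f volume) (k : ℤ) :
    unitIntervalNorm (ENNReal.ofReal (p / (p - 1))) f k ^ p =
      (∫⁻ x, (‖f (x + k)‖ₑ ^ p) ^ (1 / (p - 1)) ∂unitMeasure) ^ (1 / (1 / (p - 1))) := by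
  have hp1 : 0 < p - 1 := by linarith
  have hq : 0 < p / (p - 1) := by positivity
  rw [unitIntervalNorm_eq _ hf, eLpNorm_eq_lintegral_rpow_enorm_toReal
    (by simpa using hq) ENNReal.ofReal_ne_top, ENNReal.toReal_ofReal hq.le, ← ENNReal.rpow_mul]
  congr 1
  · refine lintegral_congr fun x => ?_
    rw [← ENNReal.rpow_mul, mul_one_div]
  · field_simp

namespace IsQuasiPeriodic

variable {G : ℝ → ℝ → ℂ} {h : ℝ → ℂ} {β δ s R : ℝ} {N : ℕ}

theorem measurableSet_jump (hG : IsQuasiPeriodic G) (s δ : ℝ) :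
    MeasurableSet {z : ℝ × ℝ | δ ≤ ‖G z.1 (z.2 + s) - G z.1 z.2‖} := by
  have h1 : Measurable fun z : ℝ × ℝ => G z.1 (z.2 + s) :=
    hG.measurable.comp (measurable_fst.prodMk (measurable_snd.add_const _))
  exact measurableSet_le measurable_const (h1.sub hG.measurable).norm

/-- For almost every x all samples h(x + k) are bounded by the local sup norms, so almost every
slice satisfies the ℓ¹ criterion. -/
theorem ae_unitMeasure_jump_eq_zero (hG : IsQuasiPeriodic G) (hh : zakInv G =ᵐ[volume] h)
    (hβ : 0 ≤ β) (hb : ∀ᵐ z ∂squareMeasure, ‖Function.uncurry G z‖ ≤ β) (hN : 0 < N) (hs : 0 ≤ s)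
    (hδ0 : 0 < δ) (hδ : 40 * β * N * s ≤ δ / 2) (hR : R < N + 1)
    (hT : amalgamTail 1 ∞ R h ≤ ENNReal.ofReal (δ / 8)) :
    squareMeasure {z | δ ≤ ‖G z.1 (z.2 + s) - G z.1 z.2‖} = 0 := by
  have hm : AEStronglyMeasurable h volume := hG.measurable_zakInv.aestronglyMeasurable.congr hh
  rw [Measure.prod_apply (hG.measurableSet_jump s δ)]
  refine lintegral_eq_zero_of_ae_eq_zero ?_
  have hess : ∀ᵐ x ∂unitMeasure, ∀ k : ℤ, ‖h (x + k)‖ₑ ≤ unitIntervalNorm ∞ h k := by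
    rw [ae_all_iff]
    intro k
    rw [unitIntervalNorm_eq _ hm, eLpNorm_exponent_top]
    exact ae_le_eLpNormEssSup
  filter_upwards [Measure.ae_ae_of_ae_prod hb, hG.ae_memLp, ae_unit_forall_add_of_ae hh, hess]
    with x h1 h2 h3 h4
  refine unitMeasure_le_norm_diff_eq_zero (hG.periodic_right x) (hG.measurable_right x) h2 hN hβ h1
    hs hδ0 hδ hR (le_trans (ENNReal.tsum_le_tsum fun k => ?_) hT)
  rw [hG.expCoeff_eq, h3, ENNReal.toReal_one, ENNReal.rpow_one]
  exact h4 k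

/-- The slice bound is integrated in x. Minkowski in L^r with r = 1/(p - 1), where r ≥ 1 because p ≤
2, moves the integral inside the sum over k. -/
theorem squareMeasure_jump_le (hG : IsQuasiPeriodic G) (hh : zakInv G =ᵐ[volume] h)
    (hβ : 0 ≤ β) (hb : ∀ᵐ z ∂squareMeasure, ‖Function.uncurry G z‖ ≤ β) (hN : 0 < N) (hs : 0 ≤ s)
    (hδ0 : 0 < δ) (hδ : 40 * β * N * s ≤ δ / 2) (hR : R < N + 1) {p : ℝ} (hp1 : 1 < p)
    (hp2 : p ≤ 2) :
    squareMeasure {z | δ ≤ ‖G z.1 (z.2 + s) - G z.1 z.2‖} ≤ ENNReal.ofReal (4 / δ) *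
      (ENNReal.ofReal (16 / δ) *
        amalgamTail (ENNReal.ofReal p) (ENNReal.ofReal (p / (p - 1))) R h) ^ (1 / (p - 1)) := by
  have hm : AEStronglyMeasurable h volume := hG.measurable_zakInv.aestronglyMeasurable.congr hh
  have hr0 : 0 < 1 / (p - 1) := one_div_pos.2 (by linarith)
  have hr : 1 ≤ 1 / (p - 1) := by rw [le_div_iff₀ (by linarith)]; linarith
  rw [Measure.prod_apply (hG.measurableSet_jump s δ)]
  have hfib : ∀ᵐ x ∂unitMeasure,
      unitMeasure (Prod.mk x ⁻¹' {z : ℝ × ℝ | δ ≤ ‖G z.1 (z.2 + s) - G z.1 z.2‖}) ≤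
        (ENNReal.ofReal (4 / δ) * ENNReal.ofReal (16 / δ) ^ (1 / (p - 1))) *
          (∑' k : {k : ℤ // R < |(k : ℝ)|}, ‖h (x + k)‖ₑ ^ p) ^ (1 / (p - 1)) := by
    filter_upwards [Measure.ae_ae_of_ae_prod hb, hG.ae_memLp, ae_unit_forall_add_of_ae hh]
      with x h1 h2 h3
    rw [mul_assoc, ← ENNReal.mul_rpow_of_nonneg _ _ hr0.le]
    simp only [← h3, ← hG.expCoeff_eq]
    exact unitMeasure_le_norm_diff_le (hG.periodic_right x) (hG.measurable_right x) h2 hN hβ h1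
      hs hδ0 hδ hR hp1 hp2
  refine (lintegral_mono_ae hfib).trans ?_
  have hmk : ∀ k : {k : ℤ // R < |(k : ℝ)|},
      AEMeasurable (fun x => ‖h (x + k)‖ₑ ^ p) unitMeasure := fun k =>
    ((hm.comp_measurePreserving
      (measurePreserving_add_right volume ((k : ℤ) : ℝ))).restrict.enorm).pow_const p
  rw [lintegral_const_mul'', ENNReal.mul_rpow_of_nonneg _ _ hr0.le, ← mul_assoc]
  · refine mul_le_mul_right ((lintegral_tsum_rpow_le hmk hr).trans (le_of_eq ?_)) _
    rw [amalgamTail, ENNReal.toReal_ofReal (by linarith)]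
    simp only [unitIntervalNorm_rpow hp1 h hm]
  · exact (AEMeasurable.tsum hmk).pow_const _

theorem ae_norm_zakDual_le
    (hb : ∀ᵐ z ∂squareMeasure, ‖Function.uncurry G z‖ ≤ β) :
    ∀ᵐ z ∂squareMeasure, ‖Function.uncurry (_root_.zakDual G) z‖ ≤ β := by
  have h1 := (Measure.measurePreserving_swap (μ := unitMeasure)
    (ν := unitMeasure)).quasiMeasurePreserving.ae hb
  filter_upwards [h1] with z hz
  simpa [Function.uncurry, _root_.zakDual] using hz

/-- A jump of G in x is a jump of the dual in its second variable, up to the change of the twist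
e^{2πixy}; that change costs at most 2πsβ ≤ δ/2 since 0 < y ≤ 1. -/
theorem measure_left_jump_le (hG : IsQuasiPeriodic G) (hs : 0 ≤ s)
    (hb : ∀ᵐ z ∂squareMeasure, ‖Function.uncurry G z‖ ≤ β) (hδ : 2 * Real.pi * s * β ≤ δ / 2) :
    squareMeasure {z | δ ≤ ‖G (z.1 + s) z.2 - G z.1 z.2‖} ≤
      squareMeasure {z | δ / 2 ≤ ‖_root_.zakDual G z.1 (z.2 + s) - _root_.zakDual G z.1 z.2‖} := by
  rw [← (Measure.measurePreserving_swap (μ := unitMeasure) (ν := unitMeasure)).measure_preimage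
    (hG.zakDual.measurableSet_jump s (δ / 2)).nullMeasurableSet]
  refine measure_mono_ae ?_
  have h0 : ∀ᵐ z ∂squareMeasure, z.2 ∈ Set.Ioc (0 : ℝ) 1 :=
    Measure.quasiMeasurePreserving_snd.ae (ae_restrict_mem measurableSet_Ioc)
  filter_upwards [hb, h0] with ⟨x, y⟩ hz hy hJ
  change δ ≤ ‖G (x + s) y - G x y‖ at hJ
  change δ / 2 ≤ ‖_root_.zakDual G y (x + s) - _root_.zakDual G y x‖
  change ‖G x y‖ ≤ β at hz
  simp only at hy
  have e : _root_.zakDual G y (x + s) - _root_.zakDual G y x = unitExp (x * y) *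
      (unitExp (s * y) * starRingEnd ℂ (G (x + s) y - G x y) +
        (unitExp (s * y) - 1) * starRingEnd ℂ (G x y)) := by
    rw [_root_.zakDual, _root_.zakDual, add_mul, unitExp_add, map_sub]
    ring
  rw [e, norm_mul, norm_unitExp, one_mul]
  have h1 : ‖(unitExp (s * y) - 1) * starRingEnd ℂ (G x y)‖ ≤ δ / 2 := by
    rw [norm_mul, RCLike.norm_conj]
    refine le_trans ?_ hδ
    gcongr
    refine (norm_unitExp_sub_one_le _).trans ?_
    rw [abs_of_nonneg (mul_nonneg hs hy.1.le)]
    have := mul_le_mul_of_nonneg_left hy.2 hs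
    gcongr
    linarith
  have h2 : ‖unitExp (s * y) * starRingEnd ℂ (G (x + s) y - G x y)‖ =
      ‖G (x + s) y - G x y‖ := by rw [norm_mul, norm_unitExp, one_mul, RCLike.norm_conj]
  have h3 := norm_sub_le_norm_add
    (unitExp (s * y) * starRingEnd ℂ (G (x + s) y - G x y))
    ((unitExp (s * y) - 1) * starRingEnd ℂ (G x y))
  linarith

end IsQuasiPeriodic

/-! ### Choice of constants and conclusion -/

/-- The shift by 1 serves negative k: the interval (k, k + 1) reaches up to k + 1, which must stay
below -R. -/
theorem amalgamTail_two_le_setLIntegral (f : ℝ → ℂ) (R : ℝ) :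
    amalgamTail 2 2 (R + 1) f ≤ ∫⁻ t in {t : ℝ | R ≤ |t|}, ‖f t‖ₑ ^ 2 := by
  have h1 : ∀ k : ℤ, unitIntervalNorm 2 f k ^ (2 : ℝ≥0∞).toReal =
      ∫⁻ t in Set.Ioo (k : ℝ) (k + 1), ‖f t‖ₑ ^ 2 := by
    intro k
    rw [unitIntervalNorm, eLpNorm_eq_lintegral_rpow_enorm_toReal two_ne_zero ENNReal.ofNat_ne_top,
      ← ENNReal.rpow_mul]
    simp
  have hdisj : Pairwise (Function.onFun Disjoint
      fun k : {k : ℤ // R + 1 < |(k : ℝ)|} => Set.Ioo ((k : ℤ) : ℝ) ((k : ℤ) + 1)) := by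
    intro i j hij
    exact (Set.pairwise_disjoint_Ioc_intCast ℝ (Subtype.coe_injective.ne hij)).mono
      Set.Ioo_subset_Ioc_self Set.Ioo_subset_Ioc_self
  simp only [amalgamTail, h1]
  rw [← lintegral_iUnion (fun _ => measurableSet_Ioo) hdisj]
  refine lintegral_mono_set (Set.iUnion_subset fun k t ht => ?_)
  have hk := k.2
  change R ≤ |t|
  rcases lt_abs.1 hk with h | h
  · exact le_abs.2 (Or.inl (by linarith [ht.1]))
  · exact le_abs.2 (Or.inr (by linarith [ht.2]))

theorem exists_amalgamTail_one_lt {f : ℝ → ℂ} (hf : ∑' k : ℤ, unitIntervalNorm ∞ f k ≠ ∞)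
    {c : ℝ≥0∞} (hc : 0 < c) : ∃ R : ℝ, 1 ≤ R ∧ amalgamTail 1 ∞ R f < c := by
  obtain ⟨s, hs⟩ := ((ENNReal.tendsto_tsum_compl_atTop_zero hf).eventually (gt_mem_nhds hc)).exists
  have h0 : 0 ≤ ∑ k ∈ s, |(k : ℝ)| := Finset.sum_nonneg fun _ _ => abs_nonneg _
  refine ⟨1 + ∑ k ∈ s, |(k : ℝ)|, by linarith, lt_of_le_of_lt ?_ hs⟩
  simp only [amalgamTail, ENNReal.toReal_one, ENNReal.rpow_one]
  have hsub : ∀ k : ℤ, 1 + ∑ k ∈ s, |(k : ℝ)| < |(k : ℝ)| → k ∉ s := by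
    intro k h2 hk
    linarith [Finset.single_le_sum (f := fun k : ℤ => |(k : ℝ)|) (fun _ _ => abs_nonneg _) hk]
  exact ENNReal.tsum_comp_le_tsum_of_injective
    (f := fun k : {k : ℤ // 1 + ∑ k ∈ s, |(k : ℝ)| < |(k : ℝ)|} =>
      (⟨k.1, hsub k.1 k.2⟩ : {k // k ∉ s}))
    (fun a b hab => Subtype.ext (Subtype.mk.inj hab)) (fun k => unitIntervalNorm ∞ f k)

theorem amalgamTail_congr {p q : ℝ≥0∞} {R : ℝ} {f g : ℝ → ℂ} (h : ∀ x, ‖f x‖ = ‖g x‖) :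
    amalgamTail p q R f = amalgamTail p q R g := by
  simp only [amalgamTail, unitIntervalNorm_congr h]

/-- The Zak transforms of `g` and of `conj ∘ ĝ` cannot both have small jump sets at the scales
`1 / (m ⌊R⌋)` and `1 / (m ⌊L⌋)`. -/
theorem exists_jump_sets {A B : ℝ} {δ : ℝ} (hδ : 0 < δ)
    (hδA : 4 * δ ≤ √A) {m : ℕ} (hm2 : 2 ≤ m) (hm : 80 * √B ≤ δ * m)
    {g : Lp ℂ 2 (volume : Measure ℝ)} (h : IsRieszBasisWithBounds A B (gaborSystem g))
    {R L : ℝ} (hR : 1 ≤ R) (hL : 1 ≤ L) :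
    ∃ G H : ℝ → ℝ → ℂ, ∃ N K : ℕ, IsQuasiPeriodic G ∧ IsQuasiPeriodic H ∧
      zakInv G =ᵐ[volume] g ∧ (zakInv H =ᵐ[volume]
        fun ξ => starRingEnd ℂ ((𝓕 g : Lp ℂ 2 (volume : Measure ℝ)) ξ)) ∧
      (∀ᵐ z ∂squareMeasure, ‖Function.uncurry G z‖ ≤ √B) ∧
      (∀ᵐ z ∂squareMeasure, ‖Function.uncurry H z‖ ≤ √B) ∧
      0 < N ∧ 0 < K ∧ R < N + 1 ∧ L < K + 1 ∧
      40 * √B * N * (1 / (m * N)) ≤ δ / 2 ∧ 40 * √B * K * (1 / (m * K)) ≤ δ / 2 ∧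
      ENNReal.ofReal (1 / (m ^ 2 * (R * L))) ≤
        squareMeasure {z | δ ≤ ‖H z.1 (z.2 + 1 / (m * K)) - H z.1 z.2‖} +
          squareMeasure {z | δ ≤ ‖G z.1 (z.2 + 1 / (m * N)) - G z.1 z.2‖} := by
  obtain ⟨G, hG, hGg, hGF⟩ := exists_zak g
  have hb := hG.ae_bounds hGg h
  have hbu : ∀ᵐ z ∂squareMeasure, ‖Function.uncurry G z‖ ≤ √B := hb.mono fun z hz => hz.2
  have hN : 0 < ⌊R⌋₊ := Nat.floor_pos.2 hR
  have hK : 0 < ⌊L⌋₊ := Nat.floor_pos.2 hL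
  set N := ⌊R⌋₊
  set K := ⌊L⌋₊
  have hNR : (N : ℝ) ≤ R := Nat.floor_le (by linarith)
  have hKL : (K : ℝ) ≤ L := Nat.floor_le (by linarith)
  have hm0 : (0 : ℝ) < m := by positivity
  have hN1 : (1 : ℝ) ≤ N := by exact_mod_cast hN
  have hK1 : (1 : ℝ) ≤ K := by exact_mod_cast hK
  -- At step 1/(mn) the Bernstein bound is 40√B/m, independent of n; this determines the size of m.
  have hlow : ∀ n : ℕ, 0 < n → 40 * √B * n * (1 / (m * n)) ≤ δ / 2 := by
    intro n hn
    have : 40 * √B * n * (1 / (m * n)) = 40 * √B / m := by field_simp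
    rw [this, div_le_iff₀ hm0]
    linarith
  have hstep : ∀ n : ℕ, 0 < n → 2 * Real.pi * (1 / (m * n)) * √B ≤ δ := by
    intro n hn
    refine le_trans ?_ ((hlow n hn).trans (by linarith))
    have h1 : 2 * Real.pi ≤ 40 * n := by
      have : (1 : ℝ) ≤ n := by exact_mod_cast hn
      linarith [Real.pi_lt_d4]
    calc 2 * Real.pi * (1 / (m * n)) * √B ≤ 40 * n * (1 / (m * n)) * √B := by gcongr
      _ = _ := by ring
  refine ⟨G, zakDual G, N, K, hG, hG.zakDual, hGg, hGF, hbu,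
    IsQuasiPeriodic.ae_norm_zakDual_le hbu, hN, hK, Nat.lt_floor_add_one R, Nat.lt_floor_add_one L,
    hlow N hN, hlow K hK, ?_⟩
  -- Jumps of size 2δ are produced because passing to the dual halves them; hence the assumption 4δ
  -- ≤ √A.
  have hj := hG.inv_mul_le_measure_jump (δ := 2 * δ) (by linarith) (by linarith)
    (K := m * K) (M := m * N) (by positivity) (by nlinarith) (by
      push_cast; exact (hstep N hN).trans (by linarith)) hb
  push_cast at hj
  refine le_trans (ENNReal.ofReal_le_ofReal ?_) (hj.trans (add_le_add ?_ (measure_mono ?_)))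
  · refine one_div_le_one_div_of_le (by positivity) ?_
    calc (m * K * (m * N) : ℝ) = m ^ 2 * (N * K) := by ring
      _ ≤ _ := by gcongr
  · have := hG.measure_left_jump_le (s := 1 / (m * K)) (δ := 2 * δ) (by positivity) hbu
      ((hstep K hK).trans (by linarith))
    rwa [mul_div_cancel_left₀ _ two_ne_zero] at this
  · intro z hz
    have hz' : 2 * δ ≤ ‖G z.1 (z.2 + 1 / (m * N)) - G z.1 z.2‖ := hz
    change δ ≤ ‖G z.1 (z.2 + 1 / (m * N)) - G z.1 z.2‖
    linarith

theorem exists_real_of_conjugate {p q : ℝ≥0∞} (hp1 : 1 ≤ p) (hp2 : p ≤ 2)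
    (hpq : 1 / p + 1 / q = 1) : (p = 1 ∧ q = ∞) ∨ ∃ r : ℝ, 1 < r ∧ r ≤ 2 ∧ p = ENNReal.ofReal r ∧
      q = ENNReal.ofReal (r / (r - 1)) ∧ (p / q).toReal = r - 1 := by
  have hpt : p ≠ ∞ := (hp2.trans_lt ENNReal.ofNat_lt_top).ne
  rcases hp1.eq_or_lt with rfl | hp
  · left
    refine ⟨rfl, ?_⟩
    rw [one_div, one_div, inv_one] at hpq
    have : q⁻¹ = 0 := by
      have h1 : (1 : ℝ≥0∞) + q⁻¹ = 1 + 0 := by rw [hpq, add_zero]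
      exact (ENNReal.add_right_inj ENNReal.one_ne_top).1 h1
    exact ENNReal.inv_eq_zero.1 this
  · right
    have hpr : p = ENNReal.ofReal p.toReal := (ENNReal.ofReal_toReal hpt).symm
    have h1 : 1 < p.toReal := by
      rw [← ENNReal.toReal_one]; exact (ENNReal.toReal_lt_toReal ENNReal.one_ne_top hpt).2 hp
    have h2 : p.toReal ≤ 2 := by
      simpa using (ENNReal.toReal_le_toReal hpt ENNReal.ofNat_ne_top).2 hp2
    set r := p.toReal
    have hr1 : 0 < r - 1 := by linarith
    have hq : q = ENNReal.ofReal (r / (r - 1)) := by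
      have h3 : q⁻¹ = ENNReal.ofReal ((r - 1) / r) := by
        have h4 : 1 / p + q⁻¹ = 1 / p + ENNReal.ofReal ((r - 1) / r) := by
          rw [← one_div q, hpq, hpr, one_div, ← ENNReal.ofReal_inv_of_pos (by linarith),
            ← ENNReal.ofReal_add (by positivity) (by positivity), ← ENNReal.ofReal_one]
          congr 1
          field_simp
          ring
        refine (ENNReal.add_right_inj ?_).1 h4
        rw [one_div]
        exact ENNReal.inv_ne_top.2 (by positivity)
      rw [← inv_inv q, h3, ← ENNReal.ofReal_inv_of_pos (by positivity), inv_div]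
    refine ⟨r, h1, h2, hpr, hq, ?_⟩
    rw [ENNReal.toReal_div, hq, ENNReal.toReal_ofReal (by positivity)]
    change r / (r / (r - 1)) = r - 1
    field_simp

/-- The power 1/(p - 1) turns X^{p-1} into X. Since 16C/δ ≤ 1 and 1/(p - 1) ≥ 1, it does not
increase 16C/δ, so one C serves all p. -/
theorem lt_of_measure_jump_le {δ m p X C : ℝ} (hδ : 0 < δ) (hm : 0 < m) (hX : 1 ≤ X) (hp1 : 1 < p)
    (hp2 : p ≤ 2) (hC0 : 0 < C) (hC1 : 16 / δ * C ≤ 1) (hC2 : C ≤ δ ^ 2 / (256 * m ^ 2))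
    {S T : ℝ≥0∞} (hS : S ≤ ENNReal.ofReal (4 / δ) * (ENNReal.ofReal (16 / δ) * T) ^ (1 / (p - 1)))
    (hT : T ≤ ENNReal.ofReal (C / X ^ (p - 1))) : S ≤ ENNReal.ofReal (1 / (4 * m ^ 2 * X)) := by
  have hr0 : 0 < p - 1 := by linarith
  have hr : 1 ≤ 1 / (p - 1) := by rw [le_div_iff₀ hr0]; linarith
  have hX0 : 0 < X := by linarith
  calc S ≤ ENNReal.ofReal (4 / δ) *
        (ENNReal.ofReal (16 / δ) * ENNReal.ofReal (C / X ^ (p - 1))) ^ (1 / (p - 1)) :=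
        hS.trans (by gcongr)
    _ = ENNReal.ofReal (4 / δ * (16 / δ * (C / X ^ (p - 1))) ^ (1 / (p - 1))) := by
        rw [← ENNReal.ofReal_mul (by positivity),
          ENNReal.ofReal_rpow_of_nonneg (by positivity) (by positivity),
          ← ENNReal.ofReal_mul (by positivity)]
    _ ≤ _ := ENNReal.ofReal_le_ofReal ?_
  have h1 : (16 / δ * (C / X ^ (p - 1))) ^ (1 / (p - 1)) =
      (16 / δ * C) ^ (1 / (p - 1)) / X := by
    rw [← mul_div_assoc, Real.div_rpow (by positivity) (by positivity), ← Real.rpow_mul hX0.le,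
      mul_one_div_cancel hr0.ne', Real.rpow_one]
  have h2 : (16 / δ * C) ^ (1 / (p - 1)) ≤ 16 / δ * C := by
    calc _ ≤ (16 / δ * C) ^ (1 : ℝ) :=
          Real.rpow_le_rpow_of_exponent_ge (by positivity) hC1 hr
      _ = _ := Real.rpow_one _
  rw [h1]
  calc 4 / δ * ((16 / δ * C) ^ (1 / (p - 1)) / X) ≤ 4 / δ * (16 / δ * C / X) := by gcongr
    _ = 64 / (δ ^ 2 * X) * C := by field_simp; norm_num
    _ ≤ 64 / (δ ^ 2 * X) * (δ ^ 2 / (256 * m ^ 2)) := by gcongr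
    _ = _ := by field_simp; norm_num

theorem exists_amalgam_bound (A B : ℝ) (hA : 0 < A) : ∃ C : ℝ, 0 < C ∧
    ∀ g : Lp ℂ 2 (volume : Measure ℝ), IsRieszBasisWithBounds A B (gaborSystem g) →
      ∀ p q : ℝ≥0∞, 1 ≤ p → p ≤ 2 → 1 / p + 1 / q = 1 → ∀ R L : ℝ, 1 ≤ R → 1 ≤ L →
        ENNReal.ofReal (C / (R * L) ^ (p / q).toReal) <
          amalgamTail p q R g + amalgamTail p q L (𝓕 g : Lp ℂ 2 (volume : Measure ℝ)) := by
  set δ : ℝ := √A / 4 with hδdef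
  have hδ : 0 < δ := by positivity
  set m : ℕ := ⌈80 * √B / δ⌉₊ + 2 with hmdef
  have hm : 80 * √B ≤ δ * m := by
    have : 80 * √B / δ ≤ m := (Nat.le_ceil _).trans (by rw [hmdef]; push_cast; linarith)
    rw [div_le_iff₀ hδ] at this
    linarith
  have hm0 : (0 : ℝ) < m := by positivity
  -- The first bound gives 16C/δ ≤ 1 and, for p = 1, C ≤ δ/8; the second makes each jump set at most
  -- a quarter of the lower bound 1/(m²RL).
  set C : ℝ := min (δ / 16) (δ ^ 2 / (256 * m ^ 2)) with hC
  have hC0 : 0 < C := by positivity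
  have hC1 : C ≤ δ / 16 := min_le_left _ _
  have hC1' : 16 / δ * C ≤ 1 := by
    calc 16 / δ * C ≤ 16 / δ * (δ / 16) := by gcongr
      _ = 1 := by field_simp
  have hC2 : C ≤ δ ^ 2 / (256 * m ^ 2) := min_le_right _ _
  refine ⟨C, hC0, fun g hg p q hp1 hp2 hpq R L hR hL => ?_⟩
  obtain ⟨G, H, N, K, hG, hH, hGg, hHg, hGb, hHb, hN, hK, hRN, hLK, hsN, hsK, hjump⟩ :=
    exists_jump_sets hδ (by rw [hδdef]; linarith) (by omega) hm hg hR hL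
  have hRL : 1 ≤ R * L := by nlinarith
  have hconj : ∀ ξ, ‖starRingEnd ℂ ((𝓕 g : Lp ℂ 2 (volume : Measure ℝ)) ξ)‖ =
      ‖(𝓕 g : Lp ℂ 2 (volume : Measure ℝ)) ξ‖ := fun ξ => RCLike.norm_conj _
  by_contra hcon
  rw [not_lt] at hcon
  have hT1 : amalgamTail p q R g ≤ ENNReal.ofReal (C / (R * L) ^ (p / q).toReal) :=
    le_self_add.trans hcon
  have hT2 : amalgamTail p q L (𝓕 g : Lp ℂ 2 (volume : Measure ℝ)) ≤
      ENNReal.ofReal (C / (R * L) ^ (p / q).toReal) := le_add_self.trans hcon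
  rw [← amalgamTail_congr hconj] at hT2
  have hB0 := Real.sqrt_nonneg B
  rcases exists_real_of_conjugate hp1 hp2 hpq with ⟨rfl, rfl⟩ | ⟨r, hr1, hr2, rfl, rfl, hr⟩
  · have hz : C / (R * L) ^ ((1 : ℝ≥0∞) / ∞).toReal ≤ δ / 8 := by
      simp only [ENNReal.div_top, ENNReal.toReal_zero, Real.rpow_zero, div_one]
      linarith
    have e1 := hG.ae_unitMeasure_jump_eq_zero hGg hB0 hGb hN (by positivity) hδ hsN hRN
      (hT1.trans (ENNReal.ofReal_le_ofReal hz))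
    have e2 := hH.ae_unitMeasure_jump_eq_zero hHg hB0 hHb hK (by positivity) hδ hsK hLK
      (hT2.trans (ENNReal.ofReal_le_ofReal hz))
    rw [e1, e2, add_zero] at hjump
    have : 0 < ENNReal.ofReal (1 / (m ^ 2 * (R * L))) := ENNReal.ofReal_pos.2 (by positivity)
    exact absurd hjump (not_le.2 this)
  · rw [hr] at hT1 hT2
    have e1 := lt_of_measure_jump_le hδ hm0 hRL hr1 hr2 hC0 hC1' hC2
      (hG.squareMeasure_jump_le hGg hB0 hGb hN (by positivity) hδ hsN hRN hr1 hr2) hT1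
    have e2 := lt_of_measure_jump_le hδ hm0 hRL hr1 hr2 hC0 hC1' hC2
      (hH.squareMeasure_jump_le hHg hB0 hHb hK (by positivity) hδ hsK hLK hr1 hr2) hT2
    have e3 := hjump.trans (add_le_add e2 e1)
    rw [← ENNReal.ofReal_add (by positivity) (by positivity),
      ENNReal.ofReal_le_ofReal_iff (by positivity)] at e3
    have e4 : 1 / (4 * m ^ 2 * (R * L)) + 1 / (4 * m ^ 2 * (R * L)) =
        1 / 2 * (1 / (m ^ 2 * (R * L))) := by field_simp; norm_num
    have e5 : 0 < 1 / (m ^ 2 * (R * L)) := by positivity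
    rw [e4] at e3
    linarith

/-- Here `𝓕 g` is the Fourier transform of `L²(ℝ)`, normalised by
`𝓕 g (ξ) = ∫ g(t) e^{-2πiξt} dt` on integrable functions. -/
theorem mainTheorem5 (A B : ℝ) (hA : 0 < A) (hB : 0 < B) :
    ∃ C : ℝ, 0 < C ∧
      ∀ g : Lp ℂ 2 (volume : Measure ℝ), IsRieszBasisWithBounds A B (gaborSystem g) →
        -- the interpolating estimate
        (∀ p q : ℝ≥0∞, 1 ≤ p → p ≤ 2 → 1 / p + 1 / q = 1 →
          ∀ R L : ℝ, 1 ≤ R → 1 ≤ L →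
            ENNReal.ofReal (C / (R * L) ^ (p / q).toReal) <
              amalgamTail p q R g + amalgamTail p q L (𝓕 g : Lp ℂ 2 (volume : Measure ℝ))) ∧
        -- the estimate that the case `p = q = 2` recovers
        (∀ R L : ℝ, 1 ≤ R → 1 ≤ L →
          ENNReal.ofReal (C / (R * L)) ≤
            (∫⁻ t in {t : ℝ | R ≤ |t|}, ‖g t‖ₑ ^ 2) +
              ∫⁻ ξ in {ξ : ℝ | L ≤ |ξ|}, ‖(𝓕 g : Lp ℂ 2 (volume : Measure ℝ)) ξ‖ₑ ^ 2) ∧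
        -- the dichotomy that the case `p = 1`, `q = ∞` recovers
        (∑' k : ℤ, unitIntervalNorm ∞ g k = ∞ ∨
          ∑' k : ℤ, unitIntervalNorm ∞ (𝓕 g : Lp ℂ 2 (volume : Measure ℝ)) k = ∞) := by
  obtain ⟨C, hC, hmain⟩ := exists_amalgam_bound A B hA
  -- The L² estimate uses R + 1 ≤ 2R and L + 1 ≤ 2L, which costs a factor 4.
  refine ⟨C / 4, by positivity, fun g hg => ⟨?_, ?_, ?_⟩⟩
  · intro p q hp1 hp2 hpq R L hR hL
    refine lt_of_le_of_lt (ENNReal.ofReal_le_ofReal ?_) (hmain g hg p q hp1 hp2 hpq R L hR hL)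
    have hRL : 0 < R * L := by positivity
    gcongr
    linarith
  · intro R L hR hL
    have h22 : 1 / (2 : ℝ≥0∞) + 1 / 2 = 1 := by simp [ENNReal.inv_two_add_inv_two]
    have h1 := hmain g hg 2 2 one_le_two le_rfl h22 (R + 1) (L + 1) (by linarith) (by linarith)
    refine le_trans (ENNReal.ofReal_le_ofReal ?_) (h1.le.trans (add_le_add
      (amalgamTail_two_le_setLIntegral _ R) (amalgamTail_two_le_setLIntegral _ L)))
    rw [ENNReal.div_self two_ne_zero ENNReal.ofNat_ne_top, ENNReal.toReal_one, Real.rpow_one,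
      div_div]
    refine div_le_div_of_nonneg_left hC.le (by positivity) ?_
    nlinarith
  · by_contra! hcon
    -- For p = 1 the lower bound C does not depend on R and L, so two convergent sums are refuted by
    -- cutting each tail below C/2.
    have hpos : 0 < ENNReal.ofReal C / 2 :=
      ENNReal.div_pos (ENNReal.ofReal_pos.2 hC).ne' ENNReal.ofNat_ne_top
    obtain ⟨R, hR, hgR⟩ := exists_amalgamTail_one_lt hcon.1 hpos
    obtain ⟨L, hL, hgL⟩ := exists_amalgamTail_one_lt hcon.2 hpos
    have h1 := hmain g hg 1 ∞ le_rfl one_le_two (by simp) R L hR hL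
    rw [ENNReal.div_top, ENNReal.toReal_zero, Real.rpow_zero, div_one] at h1
    have h2 := h1.trans (ENNReal.add_lt_add hgR hgL)
    rw [ENNReal.add_halves] at h2
    exact lt_irrefl _ h2
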